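/- **Setting.** Consider the plant $\dot x = Ax+Bu+B_ww$, $z = Cx+Du+D_ww$ with $x\in\mathbb R^n$, $u\in\mathbb R^m$, $z\in\mathbb R^r$, constant exogenous signal $w\in\mathcal W\subset\mathbb R^{n_w}$, $\mathcal W$ convex and compact, and $A$ Hurwitz. Let $G_u=-CA^{-1}B+D$, $G_w=-CA^{-1}B_w+D_w$. For $H_z\in\mathbb R^{n_c\times r}$, $H_u\in\mathbb R^{n_c\times m}$, $H_w\in\mathbb R^{n_c\times n_w}$ and convex functions $f_0:\mathcal U\to\mathbb R$, $g_0:\mathcal Z\to\mathbb R$ on convex sets $\mathcal U\subseteq\mathbb R^m$, $\mathcal Z\subseteq\mathbb R^r$, continuously differentiable with locally Lipschitz gradients on the interiors $\mathcal U^\circ,\mathcal Z^\circ$, consider $$\min_{\bar u\in\mathcal U,\ \bar z\in\mathcal Z} f_0(\bar u)+g_0(\bar z)\quad\text{s.t.}\quad \bar z=G_u\bar u+G_ww,\qquad 0=H_z\bar z+H_u\bar u+H_ww. \tag{1}$$ Assume that for each $w\in\mathcal W$ problem (1) has an optimal point in $\mathcal U^\circ\times\mathcal Z^\circ$. **Controller.**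 Let $T_z\in\mathbb R^{r\times q}$, $T_u\in\mathbb R^{m\times q}$ be such that the range of $\begin{bmatrix}T_z\\T_u\end{bmatrix}$ is the null space of $\begin{bmatrix}I_r&-G_u\\H_z&H_u\end{bmatrix}$. For $K=[K_1\ K_2]\in\mathbb R^{m\times(q+n_c)}$ and $\tau_1,\tau_2>0$ the controller is $$\tau_1\dot\eta_1=-T_u^{\mathsf T}\nabla f_0(u)-T_z^{\mathsf T}\nabla g_0(z),\qquad \tau_2\dot\eta_2=-(H_zz+H_uu+H_ww),\qquad u=K_1\eta_1+K_2\eta_2. \tag{2}$$ The closed-loop dynamics are considered where $u\in\mathcal U^\circ$ and $z\in\mathcal Z^\circ$. The controller *solves the OSS problem* if for each $w\in\mathcal W$ the closed loop has exactly one equilibrium point, this equilibrium is locally exponentially stable, and its pair $(\bar u,\bar z)$ is an optimal point of (1). **LMI.** Let $Q_1,Q_2\succeq0$ and let $\tilde f_0,\tilde g_0$ be convex and differentiable on $\mathcal U^\circ$ and $\mathcal Z^\circ$ with $\nabla f_0(u)=Q_1u+\nabla\tilde f_0(u)$ and $\nabla g_0(z)=Q_2z+\nabla\tilde g_0(z)$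 there. Put $\Delta_1=\nabla\tilde f_0$, $\Delta_2=\nabla\tilde g_0$, $d_1=m$, $d_2=r$. For $i=1,2$ let $\Theta_i\in\mathbb R^{2d_i\times2d_i}$ be a symmetric, nonsingular block $2\times 2$ matrix whose upper left $d_i\times d_i$ block is negative semidefinite and which satisfies the incremental sector constraint $$\begin{bmatrix}\Delta_i(v)-\Delta_i(v')\\v-v'\end{bmatrix}^{\mathsf T}\Theta_i\begin{bmatrix}\Delta_i(v)-\Delta_i(v')\\v-v'\end{bmatrix}\ge0$$ for all $v,v'\in\mathcal U^\circ$ ($i=1$), respectively $v,v'\in\mathcal Z^\circ$ ($i=2$). For $\theta_1,\theta_2>0$ let $\Theta$ be the matrix of the quadratic form in $(p_1,p_2,q_1,q_2)$ given by $\sum_i\theta_i^{-1}\begin{bmatrix}p_i\\q_i\end{bmatrix}^{\mathsf T}\Theta_i\begin{bmatrix}p_i\\q_i\end{bmatrix}$. Fix $\rho,\gamma>0$, put $N=H_zG_u+H_u$, $\tilde N=H_zG_w+H_w$, $Q=T_u^{\mathsf T}Q_1+T_z^{\mathsf T}Q_2G_u$, $\mathcal A=0$, $\mathcal C_1=0$,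 $\mathcal C_2=0$, $\mathcal D_1=0$, $$\mathcal B=\begin{bmatrix}-Q\\-N\end{bmatrix},\ \mathcal B_1=\mathcal D_{21}=\begin{bmatrix}-T_u^{\mathsf T}&-T_z^{\mathsf T}\\0&0\end{bmatrix},\ \mathcal B_2=\begin{bmatrix}-T_z^{\mathsf T}Q_2G_w\\-\tilde N\end{bmatrix},\ \mathcal E_1=\begin{bmatrix}I_m\\G_u\end{bmatrix},\ \mathcal D_{12}=\begin{bmatrix}0\\G_w\end{bmatrix},\ \mathcal E_2=\begin{bmatrix}-Q\\-\rho N\end{bmatrix},\ \mathcal D_2=\begin{bmatrix}-T_z^{\mathsf T}Q_2G_w\\-\rho\tilde N\end{bmatrix}.$$ The robust synthesis LMI in $Y=Y^{\mathsf T}\succ0$, $Z\in\mathbb R^{m\times(q+n_c)}$ and $\theta_1,\theta_2>0$ is $$W^{\mathsf T}\,\mathrm{diag}\!\left(\begin{bmatrix}0&-I_{q+n_c}\\-I_{q+n_c}&0\end{bmatrix},\,-\Theta^{-1},\,I_{n_w},\,-\gamma^2I_{q+n_c}\right)W\prec0, \tag{3}$$ $$W=\begin{bmatrix}-(\mathcal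 AY+\mathcal BZ)^{\mathsf T}&-(\mathcal C_1Y+\mathcal E_1Z)^{\mathsf T}&-(\mathcal C_2Y+\mathcal E_2Z)^{\mathsf T}\\I_{q+n_c}&0&0\\-\mathcal B_1^{\mathsf T}&-\mathcal D_1^{\mathsf T}&-\mathcal D_{21}^{\mathsf T}\\0&I_{m+r}&0\\-\mathcal B_2^{\mathsf T}&-\mathcal D_{12}^{\mathsf T}&-\mathcal D_2^{\mathsf T}\\0&0&I_{q+n_c}\end{bmatrix}.$$ **Proposition (Robust Optimal Stabilizer).** Let $(Y,Z,\theta_1,\theta_2)$ be feasible for (3) and set $K=ZY^{-1}$. Then there is $\tau^\star>0$ such that for every $\tau\ge\tau^\star$ the controller (2) with this $K$ and $\tau_1=\tau_2=\tau$ solves the OSS problem. -/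

import Mathlib

open Matrix Set

noncomputable section

namespace OSS

/-- A real matrix all of whose (complex) eigenvalues have negative real part. -/
def IsHurwitz {n : ℕ} (A : Matrix (Fin n) (Fin n) ℝ) : Prop :=
  ∀ s ∈ spectrum ℂ (A.map (algebraMap ℝ ℂ)), s.re < 0

/-- The data of an optimal steady-state control problem: the LTI plant
`x' = A x + B u + Bw w`, `z = C x + D u + Dw w`, the engineering constraint matrices
`Hz, Hu, Hw`, the domains `Uset`, `Zset` of the objective functions, the objective functions
`f₀`, `g₀` (only their values on `Uset`, `Zset` matter), and the set `Wset` of constant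
exogenous signals. -/
structure Data (n m r nc nw : ℕ) where
  A : Matrix (Fin n) (Fin n) ℝ
  B : Matrix (Fin n) (Fin m) ℝ
  Bw : Matrix (Fin n) (Fin nw) ℝ
  C : Matrix (Fin r) (Fin n) ℝ
  D : Matrix (Fin r) (Fin m) ℝ
  Dw : Matrix (Fin r) (Fin nw) ℝ
  Hz : Matrix (Fin nc) (Fin r) ℝ
  Hu : Matrix (Fin nc) (Fin m) ℝ
  Hw : Matrix (Fin nc) (Fin nw) ℝ
  Uset : Set (EuclideanSpace ℝ (Fin m))
  Zset : Set (EuclideanSpace ℝ (Fin r))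
  f₀ : EuclideanSpace ℝ (Fin m) → ℝ
  g₀ : EuclideanSpace ℝ (Fin r) → ℝ
  Wset : Set (EuclideanSpace ℝ (Fin nw))

namespace Data

variable {n m r nc nw q : ℕ} (S : Data n m r nc nw)

/-- DC gain from `u` to `z`. -/
def Gu : Matrix (Fin r) (Fin m) ℝ := -(S.C * S.A⁻¹ * S.B) + S.D

/-- DC gain from `w` to `z`. -/
def Gw : Matrix (Fin r) (Fin nw) ℝ := -(S.C * S.A⁻¹ * S.Bw) + S.Dw

def N : Matrix (Fin nc) (Fin m) ℝ := S.Hz * S.Gu + S.Hu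

def Ntilde : Matrix (Fin nc) (Fin nw) ℝ := S.Hz * S.Gw + S.Hw

/-- Left side of the engineering constraints. -/
def violation (w : EuclideanSpace ℝ (Fin nw)) (u : EuclideanSpace ℝ (Fin m))
    (z : EuclideanSpace ℝ (Fin r)) : EuclideanSpace ℝ (Fin nc) :=
  toEuclideanLin S.Hz z + toEuclideanLin S.Hu u + toEuclideanLin S.Hw w

/-- Feasible points of the steady-state optimization problem. -/
def IsFeasible (w : EuclideanSpace ℝ (Fin nw)) (u : EuclideanSpace ℝ (Fin m))
    (z : EuclideanSpace ℝ (Fin r)) : Prop :=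
  u ∈ S.Uset ∧ z ∈ S.Zset ∧ z = toEuclideanLin S.Gu u + toEuclideanLin S.Gw w ∧
    S.violation w u z = 0

/-- Global minimizers of `f₀(u) + g₀(z)` over the feasible points. -/
def IsOptimal (w : EuclideanSpace ℝ (Fin nw)) (u : EuclideanSpace ℝ (Fin m))
    (z : EuclideanSpace ℝ (Fin r)) : Prop :=
  S.IsFeasible w u z ∧
    ∀ u' z', S.IsFeasible w u' z' → S.f₀ u + S.g₀ z ≤ S.f₀ u' + S.g₀ z'

/-- Standing assumptions on the problem data. -/
structure StandingAssumptions : Prop where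
  hurwitz : IsHurwitz S.A
  convex_f : ConvexOn ℝ S.Uset S.f₀
  convex_g : ConvexOn ℝ S.Zset S.g₀
  contDiff_f : ContDiffOn ℝ 1 S.f₀ (interior S.Uset)
  contDiff_g : ContDiffOn ℝ 1 S.g₀ (interior S.Zset)
  lipschitz_f : LocallyLipschitzOn (interior S.Uset) (gradient S.f₀)
  lipschitz_g : LocallyLipschitzOn (interior S.Zset) (gradient S.g₀)
  convex_W : Convex ℝ S.Wset
  compact_W : IsCompact S.Wset
  exists_optimal : ∀ w ∈ S.Wset, ∃ u ∈ interior S.Uset, ∃ z ∈ interior S.Zset,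
    S.IsOptimal w u z

/-- The columns of `T = [Tz; Tu]` span the null space of `[I, -Gu; Hz, Hu]`. -/
def SpansConstraintKernel (Tz : Matrix (Fin r) (Fin q) ℝ) (Tu : Matrix (Fin m) (Fin q) ℝ) :
    Prop :=
  LinearMap.range (fromRows Tz Tu).mulVecLin
    = LinearMap.ker (fromBlocks 1 (-S.Gu) S.Hz S.Hu).mulVecLin

/-! ### The closed loop -/

/-- State `(x, η₁, η₂)` of the closed loop. -/
abbrev State (n q nc : ℕ) : Type :=
  EuclideanSpace ℝ (Fin n) × EuclideanSpace ℝ (Fin q) × EuclideanSpace ℝ (Fin nc)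

/-- Control input `u = K₁ η₁ + K₂ η₂`, where `K = [K₁ K₂]`. -/
def input (K : Matrix (Fin m) (Fin q ⊕ Fin nc) ℝ) (ξ : State n q nc) :
    EuclideanSpace ℝ (Fin m) :=
  toEuclideanLin K.toCols₁ ξ.2.1 + toEuclideanLin K.toCols₂ ξ.2.2

/-- Measured output `z = C x + D u + Dw w` of the closed loop. -/
def output (K : Matrix (Fin m) (Fin q ⊕ Fin nc) ℝ) (w : EuclideanSpace ℝ (Fin nw))
    (ξ : State n q nc) : EuclideanSpace ℝ (Fin r) :=
  toEuclideanLin S.C ξ.1 + toEuclideanLin S.D (input K ξ) + toEuclideanLin S.Dw w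

/-- States at which the closed-loop dynamics are defined: those for which `u` and `z` are
interior to the domains of `f₀` and `g₀`. -/
def domain (K : Matrix (Fin m) (Fin q ⊕ Fin nc) ℝ) (w : EuclideanSpace ℝ (Fin nw)) :
    Set (State n q nc) :=
  {ξ | input K ξ ∈ interior S.Uset ∧ S.output K w ξ ∈ interior S.Zset}

/-- Right side of the closed-loop differential equation: the plant with the controller
`τ₁ η₁' = -(Tuᵀ ∇f₀(u) + Tzᵀ ∇g₀(z))`, `τ₂ η₂' = -(Hz z + Hu u + Hw w)`,
`u = K₁ η₁ + K₂ η₂`. -/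
def closedLoop (Tz : Matrix (Fin r) (Fin q) ℝ) (Tu : Matrix (Fin m) (Fin q) ℝ)
    (K : Matrix (Fin m) (Fin q ⊕ Fin nc) ℝ) (τ₁ τ₂ : ℝ) (w : EuclideanSpace ℝ (Fin nw))
    (ξ : State n q nc) : State n q nc :=
  (toEuclideanLin S.A ξ.1 + toEuclideanLin S.B (input K ξ) + toEuclideanLin S.Bw w,
   -(τ₁⁻¹ • (toEuclideanLin Tuᵀ (gradient S.f₀ (input K ξ))
      + toEuclideanLin Tzᵀ (gradient S.g₀ (S.output K w ξ)))),
   -(τ₂⁻¹ • S.violation w (input K ξ) (S.output K w ξ)))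

end Data

/-- `x` solves `x' = F(x)` on `[0, ∞)` and stays in the domain `dom` of `F`. -/
def IsSolution {E : Type*} [NormedAddCommGroup E] [NormedSpace ℝ E] (F : E → E) (dom : Set E)
    (x : ℝ → E) : Prop :=
  ∀ t, 0 ≤ t → x t ∈ dom ∧ HasDerivWithinAt x (F (x t)) (Ici 0) t

/-- Equilibrium points of `x' = F(x)`. -/
def IsEquilibrium {E : Type*} [NormedAddCommGroup E] [NormedSpace ℝ E] (F : E → E)
    (dom : Set E) (p : E) : Prop :=
  p ∈ dom ∧ F p = 0

/-- Local exponential stability of `p` for `x' = F(x)`: from every initial state close to `p`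
a solution exists for all times, and it converges exponentially to `p`. -/
def IsLocallyExpStable {E : Type*} [NormedAddCommGroup E] [NormedSpace ℝ E] (F : E → E)
    (dom : Set E) (p : E) : Prop :=
  ∃ c > 0, ∃ lam > 0, ∃ δ > 0, ∀ x₀ : E, ‖x₀ - p‖ < δ →
    (∃ x : ℝ → E, IsSolution F dom x ∧ x 0 = x₀) ∧
    ∀ x : ℝ → E, IsSolution F dom x → x 0 = x₀ →
      ∀ t, 0 ≤ t → ‖x t - p‖ ≤ c * Real.exp (-lam * t) * ‖x₀ - p‖

namespace Data

variable {n m r nc nw q : ℕ} (S : Data n m r nc nw)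

/-- The controller solves the OSS control problem: for each `w`, the closed loop has exactly
one equilibrium point, it is locally exponentially stable, and the corresponding pair `(u, z)`
is an optimal point. -/
def SolvesOSS (Tz : Matrix (Fin r) (Fin q) ℝ) (Tu : Matrix (Fin m) (Fin q) ℝ)
    (K : Matrix (Fin m) (Fin q ⊕ Fin nc) ℝ) (τ₁ τ₂ : ℝ) : Prop :=
  ∀ w ∈ S.Wset, ∃ p : State n q nc,
    IsEquilibrium (S.closedLoop Tz Tu K τ₁ τ₂ w) (S.domain K w) p ∧
    (∀ p', IsEquilibrium (S.closedLoop Tz Tu K τ₁ τ₂ w) (S.domain K w) p' → p' = p) ∧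
    IsLocallyExpStable (S.closedLoop Tz Tu K τ₁ τ₂ w) (S.domain K w) p ∧
    S.IsOptimal w (input K p) (S.output K w p)

end Data

/-! ### Quadratic parts and incremental sector constraints -/

/-- On the interior of `s` one has `∇f(v) = Q v + ∇ft(v)` with `Q ⪰ 0` and `ft` convex and
differentiable. -/
def IsQuadraticSplit {k : ℕ} (s : Set (EuclideanSpace ℝ (Fin k)))
    (f ft : EuclideanSpace ℝ (Fin k) → ℝ) (Q : Matrix (Fin k) (Fin k) ℝ) : Prop :=
  Q.PosSemidef ∧ ConvexOn ℝ (interior s) ft ∧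
    ∀ v ∈ interior s, DifferentiableAt ℝ ft v ∧
      gradient f v = toEuclideanLin Q v + gradient ft v

/-- The incremental pointwise sector constraint
`[Δ(v) - Δ(v'); v - v']ᵀ Θ [Δ(v) - Δ(v'); v - v'] ≥ 0` for all `v, v'` in `s`. -/
def SectorConstraint {k : ℕ} (s : Set (EuclideanSpace ℝ (Fin k)))
    (Δ : EuclideanSpace ℝ (Fin k) → EuclideanSpace ℝ (Fin k))
    (Θ : Matrix (Fin k ⊕ Fin k) (Fin k ⊕ Fin k) ℝ) : Prop :=
  ∀ v ∈ s, ∀ v' ∈ s,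
    0 ≤ (Sum.elim (Δ v - Δ v').ofLp (v - v').ofLp) ⬝ᵥ
      (Θ *ᵥ (Sum.elim (Δ v - Δ v').ofLp (v - v').ofLp))

/-- `Θ` is a sector multiplier for `Δ` on `s`: symmetric, nonsingular, with negative
semidefinite upper left block, and the incremental sector constraint holds. This includes
`Θ = [0, 1; 1, 0] ⊗ I` (monotone `Δ`), `[-2, L; L, 0] ⊗ I`, `[0, 1; 1, -2μ] ⊗ I` and
`[-2, μ + L; μ + L, -2 μ L] ⊗ I` with `μ < L`, the usual choices for gradients of functions
that are convex, convex with `L`-Lipschitz gradient, `μ`-strongly convex, or both. -/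
structure IsSectorMultiplier {k : ℕ} (s : Set (EuclideanSpace ℝ (Fin k)))
    (Δ : EuclideanSpace ℝ (Fin k) → EuclideanSpace ℝ (Fin k))
    (Θ : Matrix (Fin k ⊕ Fin k) (Fin k ⊕ Fin k) ℝ) : Prop where
  symm : Θ.IsSymm
  nonsing : IsUnit Θ.det
  upperLeft : (-Θ.toBlocks₁₁).PosSemidef
  sector : SectorConstraint s Δ Θ

/-- Diagonal augmentation of two block two-by-two matrices: the matrix of the sum of the two
quadratic forms, in the variables ordered as `(p₁, p₂, q₁, q₂)`. -/
def daug {k l : ℕ} (Θ₁ : Matrix (Fin k ⊕ Fin k) (Fin k ⊕ Fin k) ℝ)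
    (Θ₂ : Matrix (Fin l ⊕ Fin l) (Fin l ⊕ Fin l) ℝ) :
    Matrix ((Fin k ⊕ Fin l) ⊕ (Fin k ⊕ Fin l)) ((Fin k ⊕ Fin l) ⊕ (Fin k ⊕ Fin l)) ℝ :=
  fromBlocks
    (fromBlocks Θ₁.toBlocks₁₁ 0 0 Θ₂.toBlocks₁₁) (fromBlocks Θ₁.toBlocks₁₂ 0 0 Θ₂.toBlocks₁₂)
    (fromBlocks Θ₁.toBlocks₂₁ 0 0 Θ₂.toBlocks₂₁) (fromBlocks Θ₁.toBlocks₂₂ 0 0 Θ₂.toBlocks₂₂)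

/-! ### Linear-fractional representation of the reduced dynamics -/

namespace Data

variable {n m r nc nw q : ℕ} (S : Data n m r nc nw)

/-- `Q = Tuᵀ Q₁ + Tzᵀ Q₂ Gu`. -/
def Qred (Tz : Matrix (Fin r) (Fin q) ℝ) (Tu : Matrix (Fin m) (Fin q) ℝ)
    (Q₁ : Matrix (Fin m) (Fin m) ℝ) (Q₂ : Matrix (Fin r) (Fin r) ℝ) :
    Matrix (Fin q) (Fin m) ℝ :=
  Tuᵀ * Q₁ + Tzᵀ * Q₂ * S.Gu

def lfrA (q nc : ℕ) : Matrix (Fin q ⊕ Fin nc) (Fin q ⊕ Fin nc) ℝ := 0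

def lfrB (Tz : Matrix (Fin r) (Fin q) ℝ) (Tu : Matrix (Fin m) (Fin q) ℝ)
    (Q₁ : Matrix (Fin m) (Fin m) ℝ) (Q₂ : Matrix (Fin r) (Fin r) ℝ) :
    Matrix (Fin q ⊕ Fin nc) (Fin m) ℝ :=
  fromRows (-S.Qred Tz Tu Q₁ Q₂) (-S.N)

def lfrB₁ (nc : ℕ) (Tz : Matrix (Fin r) (Fin q) ℝ) (Tu : Matrix (Fin m) (Fin q) ℝ) :
    Matrix (Fin q ⊕ Fin nc) (Fin m ⊕ Fin r) ℝ :=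
  fromRows (fromCols (-Tuᵀ) (-Tzᵀ)) 0

def lfrB₂ (Tz : Matrix (Fin r) (Fin q) ℝ) (Q₂ : Matrix (Fin r) (Fin r) ℝ) :
    Matrix (Fin q ⊕ Fin nc) (Fin nw) ℝ :=
  fromRows (-(Tzᵀ * Q₂ * S.Gw)) (-S.Ntilde)

def lfrC₁ (m r q nc : ℕ) : Matrix (Fin m ⊕ Fin r) (Fin q ⊕ Fin nc) ℝ := 0

def lfrE₁ : Matrix (Fin m ⊕ Fin r) (Fin m) ℝ := fromRows 1 S.Gu

def lfrD₁ (m r : ℕ) : Matrix (Fin m ⊕ Fin r) (Fin m ⊕ Fin r) ℝ := 0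

def lfrD₁₂ : Matrix (Fin m ⊕ Fin r) (Fin nw) ℝ := fromRows 0 S.Gw

def lfrC₂ (q nc : ℕ) : Matrix (Fin q ⊕ Fin nc) (Fin q ⊕ Fin nc) ℝ := 0

def lfrE₂ (Tz : Matrix (Fin r) (Fin q) ℝ) (Tu : Matrix (Fin m) (Fin q) ℝ)
    (Q₁ : Matrix (Fin m) (Fin m) ℝ) (Q₂ : Matrix (Fin r) (Fin r) ℝ) (ρ : ℝ) :
    Matrix (Fin q ⊕ Fin nc) (Fin m) ℝ :=
  fromRows (-S.Qred Tz Tu Q₁ Q₂) (-(ρ • S.N))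

def lfrD₂₁ (nc : ℕ) (Tz : Matrix (Fin r) (Fin q) ℝ) (Tu : Matrix (Fin m) (Fin q) ℝ) :
    Matrix (Fin q ⊕ Fin nc) (Fin m ⊕ Fin r) ℝ :=
  fromRows (fromCols (-Tuᵀ) (-Tzᵀ)) 0

def lfrD₂ (Tz : Matrix (Fin r) (Fin q) ℝ) (Q₂ : Matrix (Fin r) (Fin r) ℝ) (ρ : ℝ) :
    Matrix (Fin q ⊕ Fin nc) (Fin nw) ℝ :=
  fromRows (-(Tzᵀ * Q₂ * S.Gw)) (-(ρ • S.Ntilde))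

/-- The middle factor of the synthesis matrix inequality:
`diag([0, -I; -I, 0], -Θ⁻¹, I, -γ² I)`. -/
def lmiInner (nw q nc : ℕ) (γ : ℝ)
    (Θ : Matrix ((Fin m ⊕ Fin r) ⊕ (Fin m ⊕ Fin r)) ((Fin m ⊕ Fin r) ⊕ (Fin m ⊕ Fin r)) ℝ) :
    Matrix
      ((((Fin q ⊕ Fin nc) ⊕ (Fin q ⊕ Fin nc)) ⊕ ((Fin m ⊕ Fin r) ⊕ (Fin m ⊕ Fin r))) ⊕
        (Fin nw ⊕ (Fin q ⊕ Fin nc)))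
      ((((Fin q ⊕ Fin nc) ⊕ (Fin q ⊕ Fin nc)) ⊕ ((Fin m ⊕ Fin r) ⊕ (Fin m ⊕ Fin r))) ⊕
        (Fin nw ⊕ (Fin q ⊕ Fin nc))) ℝ :=
  fromBlocks
    (fromBlocks (fromBlocks 0 (-1) (-1) 0) 0 0 (-Θ⁻¹)) 0
    0 (fromBlocks 1 0 0 (-(γ ^ 2 • (1 : Matrix (Fin q ⊕ Fin nc) (Fin q ⊕ Fin nc) ℝ))))

/-- The outer factor of the synthesis matrix inequality. -/
def lmiOuter (Tz : Matrix (Fin r) (Fin q) ℝ) (Tu : Matrix (Fin m) (Fin q) ℝ)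
    (Q₁ : Matrix (Fin m) (Fin m) ℝ) (Q₂ : Matrix (Fin r) (Fin r) ℝ) (ρ : ℝ)
    (Y : Matrix (Fin q ⊕ Fin nc) (Fin q ⊕ Fin nc) ℝ) (Z : Matrix (Fin m) (Fin q ⊕ Fin nc) ℝ) :
    Matrix
      ((((Fin q ⊕ Fin nc) ⊕ (Fin q ⊕ Fin nc)) ⊕ ((Fin m ⊕ Fin r) ⊕ (Fin m ⊕ Fin r))) ⊕
        (Fin nw ⊕ (Fin q ⊕ Fin nc)))
      (((Fin q ⊕ Fin nc) ⊕ (Fin m ⊕ Fin r)) ⊕ (Fin q ⊕ Fin nc)) ℝ :=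
  fromRows
    (fromRows
      (fromRows
        (fromCols (fromCols
          (-(lfrA q nc * Y + S.lfrB Tz Tu Q₁ Q₂ * Z)ᵀ)
          (-(lfrC₁ m r q nc * Y + S.lfrE₁ * Z)ᵀ))
          (-(lfrC₂ q nc * Y + S.lfrE₂ Tz Tu Q₁ Q₂ ρ * Z)ᵀ))
        (fromCols (fromCols 1 0) 0))
      (fromRows
        (fromCols (fromCols (-(lfrB₁ nc Tz Tu)ᵀ) (-(lfrD₁ m r)ᵀ)) (-(lfrD₂₁ nc Tz Tu)ᵀ))
        (fromCols (fromCols 0 1) 0)))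
    (fromRows
      (fromCols (fromCols (-(S.lfrB₂ Tz Q₂)ᵀ) (-(S.lfrD₁₂)ᵀ)) (-(S.lfrD₂ Tz Q₂ ρ)ᵀ))
      (fromCols (fromCols 0 0) 1))

/-- `(Y, Z, θ₁, θ₂)` is feasible for the robust synthesis LMI with multipliers `Θ₁, Θ₂`,
weight `ρ` and performance level `γ`. -/
def SynthesisLMI (Tz : Matrix (Fin r) (Fin q) ℝ) (Tu : Matrix (Fin m) (Fin q) ℝ)
    (Q₁ : Matrix (Fin m) (Fin m) ℝ) (Q₂ : Matrix (Fin r) (Fin r) ℝ)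
    (Θ₁ : Matrix (Fin m ⊕ Fin m) (Fin m ⊕ Fin m) ℝ)
    (Θ₂ : Matrix (Fin r ⊕ Fin r) (Fin r ⊕ Fin r) ℝ) (ρ γ : ℝ)
    (Y : Matrix (Fin q ⊕ Fin nc) (Fin q ⊕ Fin nc) ℝ) (Z : Matrix (Fin m) (Fin q ⊕ Fin nc) ℝ)
    (θ₁ θ₂ : ℝ) : Prop :=
  Y.PosDef ∧ 0 < θ₁ ∧ 0 < θ₂ ∧
    (-((S.lmiOuter Tz Tu Q₁ Q₂ ρ Y Z)ᵀ *
        lmiInner nw q nc γ (daug (θ₁⁻¹ • Θ₁) (θ₂⁻¹ • Θ₂)) *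
        S.lmiOuter Tz Tu Q₁ Q₂ ρ Y Z)).PosDef

end Data

end OSS

end

open Matrix Set

noncomputable section

namespace OSS

/-! Replace the plant by its steady state: the controller then obeys a reduced system in `η` alone,
whose vector field is `slowField` evaluated at `dcOutput`. Restricting the synthesis inequality to
vectors with zero last block and dualizing (`dualization`, which needs the negative semidefinite
upper left block of the multiplier) gives a dissipation inequality. The sector constraints turn it
into strong monotonicity of the negated reduced field in the metric `Y⁻¹`, uniformly in `w`
(`SynthesisLMI.slowField_dissipation`).

Equilibria. The same inequality makes the gain `K` injective, and counting dimensions in the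
constraint kernel makes it square, hence bijective (`SynthesisLMI.gain_bijective`). So the interior
optimizer is produced by some controller state, and first-order necessity makes that state a zero of
the reduced field (`IsOptimal.slowField_eq_zero`). Monotonicity allows only one zero, so the unique
equilibrium is that optimizer; sufficiency of the first-order conditions is never invoked.

Stability. The deviation of the plant from its quasi-steady state has a quadratic Lyapunov function
because `A` is Hurwitz (`IsHurwitz.exists_lyapunov`). Adding the `Y⁻¹` form of the controller error
gives a Lyapunov function for the closed loop, the cross terms being absorbed when the controller is
slow (`exists_timescale_stable`).

One threshold for all `w`. The threshold depends on the equilibrium only through a Lipschitz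
constant of the gradients near it. Monotonicity makes the equilibrium continuous in `w`
(`SlowDissipative.continuousOn`), so compactness of the signal set gives a common constant
(`exists_uniform_lipschitz`). -/

/-! ### Quadratic forms and dualization. -/

theorem exists_pos_mul_dotProduct_le {κ : Type*} [Fintype κ] [DecidableEq κ]
    {M : Matrix κ κ ℝ} (hM : M.PosDef) :
    ∃ ε > 0, ∀ x : κ → ℝ, ε * (x ⬝ᵥ x) ≤ x ⬝ᵥ (M *ᵥ x) := by
  rcases isEmpty_or_nonempty κ with hκ | hκ
  · exact ⟨1, one_pos, fun x => by simp [dotProduct]⟩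
  have hpos : ∀ x : κ → ℝ, x ≠ 0 → 0 < x ⬝ᵥ (M *ᵥ x) := fun x hx => by
    simpa using hM.dotProduct_mulVec_pos hx
  have hcont : Continuous fun x : κ → ℝ => x ⬝ᵥ (M *ᵥ x) := by
    simp only [dotProduct, mulVec]; fun_prop
  have hcont' : Continuous fun x : κ → ℝ => x ⬝ᵥ x := by
    simp only [dotProduct]; fun_prop
  -- The norm on `κ → ℝ` is the sup norm, so `x ⬝ᵥ x` is not constant on this sphere; its maximum
  -- enters the constant as a denominator.
  obtain ⟨x₀, hx₀, hmin⟩ := (isCompact_sphere (0 : κ → ℝ) 1).exists_isMinOn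
    (NormedSpace.sphere_nonempty.2 zero_le_one) hcont.continuousOn
  obtain ⟨x₁, hx₁, hmax⟩ := (isCompact_sphere (0 : κ → ℝ) 1).exists_isMaxOn
    (NormedSpace.sphere_nonempty.2 zero_le_one) hcont'.continuousOn
  have h0 : 0 < x₀ ⬝ᵥ (M *ᵥ x₀) := hpos x₀ (ne_zero_of_mem_unit_sphere ⟨x₀, hx₀⟩)
  have h1 : 0 < x₁ ⬝ᵥ x₁ := by
    have := Matrix.dotProduct_star_self_pos_iff (v := x₁) |>.2
      (ne_zero_of_mem_unit_sphere ⟨x₁, hx₁⟩)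
    simpa using this
  refine ⟨(x₀ ⬝ᵥ (M *ᵥ x₀)) / (x₁ ⬝ᵥ x₁), div_pos h0 h1, fun x => ?_⟩
  rcases eq_or_ne x 0 with rfl | hx
  · simp
  have hn : 0 < ‖x‖ := norm_pos_iff.2 hx
  set y := ‖x‖⁻¹ • x with hy
  have hyS : y ∈ Metric.sphere (0 : κ → ℝ) 1 := by
    simp [hy, norm_smul, hn.ne']
  have hxy : x = ‖x‖ • y := by simp [hy, smul_smul, hn.ne']
  have e1 : x ⬝ᵥ x = ‖x‖ ^ 2 * (y ⬝ᵥ y) := by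
    conv_lhs => rw [hxy]
    simp only [smul_dotProduct, dotProduct_smul, smul_eq_mul]; ring
  have e2 : x ⬝ᵥ (M *ᵥ x) = ‖x‖ ^ 2 * (y ⬝ᵥ (M *ᵥ y)) := by
    conv_lhs => rw [hxy]
    simp only [mulVec_smul, smul_dotProduct, dotProduct_smul, smul_eq_mul]; ring
  have hA : x₀ ⬝ᵥ (M *ᵥ x₀) ≤ y ⬝ᵥ (M *ᵥ y) := hmin hyS
  have hB : y ⬝ᵥ y ≤ x₁ ⬝ᵥ x₁ := hmax hyS
  rw [e1, e2, div_mul_eq_mul_div, div_le_iff₀ h1]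
  have h2 : x₀ ⬝ᵥ (M *ᵥ x₀) * (y ⬝ᵥ y) ≤ y ⬝ᵥ (M *ᵥ y) * (x₁ ⬝ᵥ x₁) :=
    mul_le_mul hA hB (by simpa using dotProduct_star_self_nonneg y) (h0.le.trans hA)
  nlinarith [sq_nonneg ‖x‖]

theorem sumElim_dotProduct {α β : Type*} [Fintype α] [Fintype β] (a a' : α → ℝ) (b b' : β → ℝ) :
    Sum.elim a b ⬝ᵥ Sum.elim a' b' = a ⬝ᵥ a' + b ⬝ᵥ b' := by
  simp [dotProduct, Fintype.sum_sum_type]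

theorem dotProduct_transpose_mulVec {α β : Type*} [Fintype α] [Fintype β] (M : Matrix α β ℝ)
    (x : β → ℝ) (y : α → ℝ) : x ⬝ᵥ (Mᵀ *ᵥ y) = y ⬝ᵥ (M *ᵥ x) := by
  rw [dotProduct_mulVec, vecMul_transpose, dotProduct_comm]

/-- Dualization: if the inverse form is positive on the orthogonal complement, the form itself is
negative on the graph subspace. -/
theorem dualization {κ ι : Type*} [Fintype κ] [DecidableEq κ] [Fintype ι] [DecidableEq ι]
    (F : Matrix κ κ ℝ) (G : Matrix κ ι ℝ) (H : Matrix ι κ ℝ) (Θ : Matrix (ι ⊕ ι) (ι ⊕ ι) ℝ)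
    (hs : Θ.IsSymm) (hu : IsUnit Θ.det) (h11 : (-Θ.toBlocks₁₁).PosSemidef) {ε : ℝ} (hε : 0 < ε)
    (hdual : ∀ a : κ → ℝ, ∀ b : ι → ℝ, ε * (a ⬝ᵥ a + b ⬝ᵥ b) ≤
      -(2 * (a ⬝ᵥ (F *ᵥ a)) + 2 * (b ⬝ᵥ (H *ᵥ a)) -
        Sum.elim (-(Gᵀ *ᵥ a)) b ⬝ᵥ (Θ⁻¹ *ᵥ Sum.elim (-(Gᵀ *ᵥ a)) b))) (ζ : κ → ℝ) (p : ι → ℝ) :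
    2 * (ζ ⬝ᵥ (F *ᵥ ζ + G *ᵥ p)) + Sum.elim p (H *ᵥ ζ) ⬝ᵥ (Θ *ᵥ Sum.elim p (H *ᵥ ζ)) ≤
      -ε * (ζ ⬝ᵥ ζ) := by
  set R := (Θ⁻¹).toBlocks₂₂ with hR
  have hΘ : Θ⁻¹ = fromBlocks (Θ⁻¹).toBlocks₁₁ (Θ⁻¹).toBlocks₁₂ (Θ⁻¹).toBlocks₂₁ R :=
    (fromBlocks_toBlocks _).symm
  have hRinj : Function.Injective R.mulVec := by
    rw [← Matrix.coe_mulVecLin, ← LinearMap.ker_eq_bot, LinearMap.ker_eq_bot']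
    intro b hb
    -- With `a = 0` the hypothesis says that the form of `R` dominates `ε` times the square of the
    -- length.
    have h := hdual 0 b
    rw [hΘ, fromBlocks_mulVec] at h
    simp only [Matrix.mulVecLin_apply] at hb
    have hb0 : ∀ c : ι → ℝ, Sum.elim (-(Gᵀ *ᵥ (0 : κ → ℝ))) b ⬝ᵥ Sum.elim c (0 : ι → ℝ) = 0 := by
      intro c; rw [sumElim_dotProduct]; simp
    simp only [mulVec_zero, neg_zero, Sum.elim_comp_inl, Sum.elim_comp_inr, hb, zero_add,
      dotProduct_zero, mul_zero, sumElim_dotProduct, zero_dotProduct] at h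
    have h' : b ⬝ᵥ b ≤ 0 := by
      by_contra hc; push Not at hc; nlinarith
    have := dotProduct_star_self_nonneg b
    exact dotProduct_self_eq_zero.1 (le_antisymm h' (by simpa using this))
  have hRsurj : Function.Surjective R.mulVec :=
    (LinearMap.injective_iff_surjective (f := R.mulVecLin)).1 hRinj
  -- This `b` makes the second block of `Θ⁻¹ y` equal to `H ζ`, so the dual vector `y` corresponds
  -- to a primal vector that differs from `(p, H ζ)` only in its first block.
  obtain ⟨b, hb⟩ := hRsurj (H *ᵥ ζ + (Θ⁻¹).toBlocks₂₁ *ᵥ (Gᵀ *ᵥ ζ))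
  set y : ι ⊕ ι → ℝ := Sum.elim (-(Gᵀ *ᵥ ζ)) b with hy
  set pu := (Θ⁻¹).toBlocks₁₁ *ᵥ (-(Gᵀ *ᵥ ζ)) + (Θ⁻¹).toBlocks₁₂ *ᵥ b with hpu
  have htu : Θ⁻¹ *ᵥ y = Sum.elim pu (H *ᵥ ζ) := by
    conv_lhs => rw [hΘ, fromBlocks_mulVec]
    simp only [hy, Sum.elim_comp_inl, Sum.elim_comp_inr]
    change R *ᵥ b = _ at hb
    rw [hb, ← hpu, mulVec_neg]
    congr 1
    abel
  have hty : Θ *ᵥ Sum.elim pu (H *ᵥ ζ) = y := by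
    rw [← htu, mulVec_mulVec, mul_nonsing_inv _ hu, one_mulVec]
  have hsymm : ∀ s t : ι ⊕ ι → ℝ, s ⬝ᵥ (Θ *ᵥ t) = t ⬝ᵥ (Θ *ᵥ s) := fun s t => by
    rw [dotProduct_mulVec, dotProduct_comm, ← mulVec_transpose, hs.eq]
  -- The form is concave along `(d, 0)` by the sign of the upper left block. The cross term cancels
  -- `2 ζ ⬝ᵥ G p`, and what remains is the dual inequality at `(ζ, b)`.
  set d := p - pu with hd
  have ht : Sum.elim p (H *ᵥ ζ) = Sum.elim d 0 + Sum.elim pu (H *ᵥ ζ) := by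
    ext i; rcases i with i | i <;> simp [hd]
  have hdd : Sum.elim d (0 : ι → ℝ) ⬝ᵥ (Θ *ᵥ Sum.elim d 0) ≤ 0 := by
    have h := h11.dotProduct_mulVec_nonneg d
    rw [← fromBlocks_toBlocks Θ, fromBlocks_mulVec]
    simp only [Sum.elim_comp_inl, Sum.elim_comp_inr, sumElim_dotProduct, mulVec_zero, add_zero,
      zero_dotProduct]
    simpa [neg_mulVec] using h
  have h := hdual ζ b
  rw [← hy, htu] at h
  rw [ht, mulVec_add, add_dotProduct, dotProduct_add, dotProduct_add (Sum.elim pu _),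
    dotProduct_add (Sum.elim d _), hsymm (Sum.elim pu _) (Sum.elim d 0), hty, dotProduct_comm (Sum.elim pu _)]
  have e1 : Sum.elim d (0 : ι → ℝ) ⬝ᵥ y = -(ζ ⬝ᵥ (G *ᵥ p)) + pu ⬝ᵥ (Gᵀ *ᵥ ζ) := by
    rw [hy, sumElim_dotProduct, zero_dotProduct, dotProduct_neg, hd, sub_dotProduct,
      dotProduct_mulVec p, vecMul_transpose, dotProduct_comm (G *ᵥ p)]
    ring
  have e2 : y ⬝ᵥ Sum.elim pu (H *ᵥ ζ) = -(pu ⬝ᵥ (Gᵀ *ᵥ ζ)) + b ⬝ᵥ (H *ᵥ ζ) := by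
    rw [hy, sumElim_dotProduct, neg_dotProduct, dotProduct_comm pu]
  rw [e2] at h
  rw [e1, e2]
  have hbb : 0 ≤ b ⬝ᵥ b := by simpa using dotProduct_star_self_nonneg b
  have := mul_nonneg hε.le hbb
  linarith

/-! ### Diagonal augmentation of multipliers. -/

theorem daug_isSymm {k l : ℕ} {Θ₁ : Matrix (Fin k ⊕ Fin k) (Fin k ⊕ Fin k) ℝ}
    {Θ₂ : Matrix (Fin l ⊕ Fin l) (Fin l ⊕ Fin l) ℝ} (h₁ : Θ₁.IsSymm) (h₂ : Θ₂.IsSymm) :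
    (daug Θ₁ Θ₂).IsSymm := by
  ext i j
  rcases i with (i | i) | (i | i) <;> rcases j with (j | j) | (j | j) <;>
    simp [daug, toBlocks₁₁, toBlocks₁₂, toBlocks₂₁, toBlocks₂₂, h₁.apply, h₂.apply]

/-- Up to a reordering of the index set, `daug` is a block diagonal sum. Multiplicativity is what
carries nonsingularity over from the two blocks. -/
theorem daug_mul {k l : ℕ} (A₁ B₁ : Matrix (Fin k ⊕ Fin k) (Fin k ⊕ Fin k) ℝ)
    (A₂ B₂ : Matrix (Fin l ⊕ Fin l) (Fin l ⊕ Fin l) ℝ) :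
    daug A₁ A₂ * daug B₁ B₂ = daug (A₁ * B₁) (A₂ * B₂) := by
  ext i j
  rcases i with (i | i) | (i | i) <;> rcases j with (j | j) | (j | j) <;>
    simp [daug, toBlocks₁₁, toBlocks₁₂, toBlocks₂₁, toBlocks₂₂, Matrix.mul_apply,
      Fintype.sum_sum_type]

theorem daug_one {k l : ℕ} : daug (1 : Matrix (Fin k ⊕ Fin k) (Fin k ⊕ Fin k) ℝ)
    (1 : Matrix (Fin l ⊕ Fin l) (Fin l ⊕ Fin l) ℝ) = 1 := by
  ext i j
  rcases i with (i | i) | (i | i) <;> rcases j with (j | j) | (j | j) <;>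
    simp [daug, toBlocks₁₁, toBlocks₁₂, toBlocks₂₁, toBlocks₂₂, Matrix.one_apply]

theorem isUnit_det_daug {k l : ℕ} {Θ₁ : Matrix (Fin k ⊕ Fin k) (Fin k ⊕ Fin k) ℝ}
    {Θ₂ : Matrix (Fin l ⊕ Fin l) (Fin l ⊕ Fin l) ℝ} (h₁ : IsUnit Θ₁.det) (h₂ : IsUnit Θ₂.det) :
    IsUnit (daug Θ₁ Θ₂).det := by
  rw [← isUnit_iff_isUnit_det]
  refine IsUnit.of_mul_eq_one (daug Θ₁⁻¹ Θ₂⁻¹) ?_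
  rw [daug_mul, mul_nonsing_inv _ h₁, mul_nonsing_inv _ h₂, daug_one]

theorem dotProduct_daug_mulVec {k l : ℕ} (Θ₁ : Matrix (Fin k ⊕ Fin k) (Fin k ⊕ Fin k) ℝ)
    (Θ₂ : Matrix (Fin l ⊕ Fin l) (Fin l ⊕ Fin l) ℝ) (p₁ q₁ : Fin k → ℝ) (p₂ q₂ : Fin l → ℝ) :
    Sum.elim (Sum.elim p₁ p₂) (Sum.elim q₁ q₂) ⬝ᵥ
      (daug Θ₁ Θ₂ *ᵥ Sum.elim (Sum.elim p₁ p₂) (Sum.elim q₁ q₂)) =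
    Sum.elim p₁ q₁ ⬝ᵥ (Θ₁ *ᵥ Sum.elim p₁ q₁) + Sum.elim p₂ q₂ ⬝ᵥ (Θ₂ *ᵥ Sum.elim p₂ q₂) := by
  conv_rhs => rw [← fromBlocks_toBlocks Θ₁, ← fromBlocks_toBlocks Θ₂]
  simp only [daug, fromBlocks_mulVec, Sum.elim_comp_inl, Sum.elim_comp_inr, sumElim_dotProduct,
    zero_mulVec, add_zero, zero_add, dotProduct_add]
  ring

/-! ### From the synthesis inequality to dissipation. -/

namespace Data

variable {n m r nc nw q : ℕ} (S : Data n m r nc nw)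

/-- Feasibility of the synthesis inequality gives strict dissipation on the primal side. -/
theorem SynthesisLMI.dissipation {Tz : Matrix (Fin r) (Fin q) ℝ} {Tu : Matrix (Fin m) (Fin q) ℝ}
    {Q₁ : Matrix (Fin m) (Fin m) ℝ} {Q₂ : Matrix (Fin r) (Fin r) ℝ}
    {Θ₁ : Matrix (Fin m ⊕ Fin m) (Fin m ⊕ Fin m) ℝ}
    {Θ₂ : Matrix (Fin r ⊕ Fin r) (Fin r ⊕ Fin r) ℝ} {ρ γ : ℝ}
    {Y : Matrix (Fin q ⊕ Fin nc) (Fin q ⊕ Fin nc) ℝ} {Z : Matrix (Fin m) (Fin q ⊕ Fin nc) ℝ}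
    {θ₁ θ₂ : ℝ} (h : S.SynthesisLMI Tz Tu Q₁ Q₂ Θ₁ Θ₂ ρ γ Y Z θ₁ θ₂)
    (hs₁ : Θ₁.IsSymm) (hs₂ : Θ₂.IsSymm) (hu₁ : IsUnit Θ₁.det) (hu₂ : IsUnit Θ₂.det)
    (h₁ : (-Θ₁.toBlocks₁₁).PosSemidef) (h₂ : (-Θ₂.toBlocks₁₁).PosSemidef) :
    ∃ ε > 0, ∀ (ζ : Fin q ⊕ Fin nc → ℝ) (p : Fin m ⊕ Fin r → ℝ),
      2 * (ζ ⬝ᵥ ((S.lfrB Tz Tu Q₁ Q₂ * Z) *ᵥ ζ + lfrB₁ nc Tz Tu *ᵥ p)) +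
        Sum.elim p ((S.lfrE₁ * Z) *ᵥ ζ) ⬝ᵥ
          (daug (θ₁⁻¹ • Θ₁) (θ₂⁻¹ • Θ₂) *ᵥ Sum.elim p ((S.lfrE₁ * Z) *ᵥ ζ)) ≤
      -ε * (ζ ⬝ᵥ ζ) := by
  obtain ⟨-, hθ₁, hθ₂, hP⟩ := h
  obtain ⟨ε, hε, hP⟩ := exists_pos_mul_dotProduct_le hP
  refine ⟨ε, hε, dualization _ _ _ _ ?_ ?_ ?_ hε ?_⟩
  · exact daug_isSymm (hs₁.smul _) (hs₂.smul _)
  · apply isUnit_det_daug <;> rw [det_smul]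
    · exact ((inv_ne_zero hθ₁.ne').isUnit.pow _).mul hu₁
    · exact ((inv_ne_zero hθ₂.ne').isUnit.pow _).mul hu₂
  · refine .of_dotProduct_mulVec_nonneg ?_ fun x => ?_
    · ext i j
      rcases i with i | i <;> rcases j with j | j <;>
        simp [daug, toBlocks₁₁, hs₁.apply, hs₂.apply]
    · have e₁ := h₁.dotProduct_mulVec_nonneg (x ∘ Sum.inl)
      have e₂ := h₂.dotProduct_mulVec_nonneg (x ∘ Sum.inr)
      have e : (daug (θ₁⁻¹ • Θ₁) (θ₂⁻¹ • Θ₂)).toBlocks₁₁ =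
          fromBlocks (θ₁⁻¹ • Θ₁.toBlocks₁₁) 0 0 (θ₂⁻¹ • Θ₂.toBlocks₁₁) := rfl
      have hx : x = Sum.elim (x ∘ Sum.inl) (x ∘ Sum.inr) := (Sum.elim_comp_inl_inr x).symm
      rw [e, neg_mulVec, fromBlocks_mulVec, dotProduct_neg]
      simp only [star_trivial, neg_mulVec, dotProduct_neg] at e₁ e₂ ⊢
      conv_rhs => rw [hx]
      rw [sumElim_dotProduct]
      simp only [zero_mulVec, add_zero, zero_add, smul_mulVec, dotProduct_smul, smul_eq_mul,
        Sum.elim_comp_inl, Sum.elim_comp_inr]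
      have := mul_nonneg (inv_nonneg.2 hθ₁.le) e₁
      have := mul_nonneg (inv_nonneg.2 hθ₂.le) e₂
      linarith
  · intro a b
    -- The zero last block removes the performance output together with `ρ` and `γ`; the performance
    -- input leaves only the nonnegative term `v ⬝ᵥ v`, which can be dropped.
    have h := hP (Sum.elim (Sum.elim a b) 0)
    rw [neg_mulVec, dotProduct_neg, ← mulVec_mulVec, ← mulVec_mulVec, dotProduct_mulVec _ _ᵀ,
      vecMul_transpose] at h
    simp only [lmiOuter, lmiInner, fromRows_mulVec, fromCols_mulVec, Sum.elim_comp_inl,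
      Sum.elim_comp_inr, fromBlocks_mulVec, sumElim_dotProduct, zero_mulVec, mulVec_zero,
      add_zero, zero_add, one_mulVec, neg_mulVec, dotProduct_neg, lfrA, lfrC₁,
      zero_mul, Matrix.zero_mul, lfrD₁, transpose_zero, neg_zero, dotProduct_zero] at h
    set v := -((S.lfrB₂ Tz Q₂)ᵀ *ᵥ a) + -(S.lfrD₁₂ᵀ *ᵥ b)
    have hv : 0 ≤ v ⬝ᵥ v := by simpa using dotProduct_star_self_nonneg v
    rw [dotProduct_comm (_ + _) a] at h
    simp only [dotProduct_add, dotProduct_neg, dotProduct_transpose_mulVec] at h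
    linarith

end Data

/-! ### Lyapunov functions for Hurwitz matrices. -/

/-- Gelfand's formula: the norms of the powers are eventually below `c ^ k` for some `c < 1` above
the spectral radius. -/
theorem exists_norm_pow_lt_of_spectrum {𝒜 : Type*} [NormedRing 𝒜] [NormedAlgebra ℂ 𝒜]
    [CompleteSpace 𝒜] [Nontrivial 𝒜] (a : 𝒜) (h : ∀ μ ∈ spectrum ℂ a, ‖μ‖ < 1) {δ : ℝ}
    (hδ : 0 < δ) : ∃ k : ℕ, 0 < k ∧ ‖a ^ k‖ < δ := by
  have hr : spectralRadius ℂ a < 1 := by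
    have := spectrum.spectralRadius_lt_of_forall_lt a (r := 1) fun μ hμ => by
      have := h μ hμ
      exact_mod_cast this
    simpa using this
  obtain ⟨c, hc0, hc1⟩ := ENNReal.lt_iff_exists_nnreal_btwn.1 hr
  have hc1' : c < 1 := by exact_mod_cast hc1
  have hev := (spectrum.pow_nnnorm_pow_one_div_tendsto_nhds_spectralRadius a).eventually_lt_const hc0
  have hpow : ∀ᶠ k : ℕ in Filter.atTop, (c : ℝ) ^ k < δ :=
    (tendsto_pow_atTop_nhds_zero_of_lt_one c.2 (by exact_mod_cast hc1')).eventually_lt_const hδ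
  obtain ⟨k, ⟨hk, hkδ⟩, hk0⟩ := ((hev.and hpow).and (Filter.eventually_gt_atTop 0)).exists
  refine ⟨k, hk0, lt_of_le_of_lt ?_ hkδ⟩
  have h2 := ENNReal.rpow_le_rpow hk.le (Nat.cast_nonneg k : (0 : ℝ) ≤ k)
  rw [← ENNReal.rpow_mul, one_div, inv_mul_cancel₀ (by positivity), ENNReal.rpow_one,
    ENNReal.rpow_natCast] at h2
  have h3 : ‖a ^ k‖₊ ≤ c ^ k := by exact_mod_cast h2
  exact_mod_cast h3

/-- The Cayley transform sends the left half-plane to the unit disc: a spectral value `μ` of the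
transform comes from `(μ - 1) / (μ + 1)` in the spectrum of `a`, whose real part has the sign of
`‖μ‖ ^ 2 - 1`. This reduces the continuous-time Lyapunov theorem to powers of a matrix, avoiding the
matrix exponential. -/
theorem norm_lt_one_of_mem_spectrum_cayley {𝒜 : Type*} [Ring 𝒜] [Algebra ℂ 𝒜] {a b : 𝒜}
    (hb : (1 - a) * b = 1) (hb' : b * (1 - a) = 1) (h : ∀ s ∈ spectrum ℂ a, s.re < 0) {μ : ℂ}
    (hμ : μ ∈ spectrum ℂ ((1 + a) * b)) : ‖μ‖ < 1 := by
  have hub : IsUnit b := ⟨⟨b, 1 - a, hb', hb⟩, rfl⟩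
  have key : algebraMap ℂ 𝒜 μ - (1 + a) * b = ((μ - 1) • (1 : 𝒜) - (μ + 1) • a) * b := by
    have : algebraMap ℂ 𝒜 μ = (μ • (1 - a)) * b := by
      rw [smul_mul_assoc, hb, Algebra.algebraMap_eq_smul_one]
    rw [this, ← sub_mul]
    congr 1
    simp only [smul_sub, sub_smul, add_smul, one_smul]
    abel
  rw [spectrum.mem_iff, key, hub.mul_right_iff] at hμ
  have hμ1 : μ + 1 ≠ 0 := by
    intro h0
    apply hμ
    rw [h0, zero_smul, sub_zero, ← Algebra.algebraMap_eq_smul_one]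
    have : μ - 1 ≠ 0 := by
      have : μ = -1 := by linear_combination h0
      rw [this]; norm_num
    exact (IsUnit.mk0 _ this).map (algebraMap ℂ 𝒜)
  have hmem : (μ - 1) / (μ + 1) ∈ spectrum ℂ a := by
    rw [spectrum.mem_iff]
    intro hu
    apply hμ
    have h2 := ((IsUnit.mk0 _ hμ1).map (algebraMap ℂ 𝒜)).mul hu
    convert h2 using 1
    rw [mul_sub, ← map_mul, mul_div_cancel₀ _ hμ1, Algebra.algebraMap_eq_smul_one,
      Algebra.algebraMap_eq_smul_one, smul_mul_assoc, one_mul]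
  have hre := h _ hmem
  rw [Complex.div_re, ← add_div, div_lt_iff₀ (Complex.normSq_pos.2 hμ1), zero_mul] at hre
  simp only [Complex.sub_re, Complex.add_re, Complex.one_re, Complex.sub_im, Complex.add_im,
    Complex.one_im] at hre
  have : Complex.normSq μ < 1 := by rw [Complex.normSq_apply]; nlinarith
  rw [Complex.normSq_eq_norm_sq] at this
  exact (sq_lt_one_iff₀ (norm_nonneg _)).1 this

theorem IsHurwitz.isUnit_det {n : ℕ} {A : Matrix (Fin n) (Fin n) ℝ} (hA : IsHurwitz A) :
    IsUnit A.det := by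
  have h0 : (0 : ℂ) ∉ spectrum ℂ (A.map (algebraMap ℝ ℂ)) := fun h => by
    simpa using hA 0 h
  rw [spectrum.zero_notMem_iff, isUnit_iff_isUnit_det] at h0
  rw [isUnit_iff_ne_zero] at h0 ⊢
  intro h
  apply h0
  have := RingHom.map_det (algebraMap ℝ ℂ) A
  rw [h, map_zero] at this
  exact this.symm

open scoped Matrix.Norms.L2Operator in
theorem exists_pow_dotProduct_le {n : ℕ} (M : Matrix (Fin n) (Fin n) ℝ)
    (h : ∀ μ ∈ spectrum ℂ (M.map (algebraMap ℝ ℂ)), ‖μ‖ < 1) :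
    ∃ k : ℕ, 0 < k ∧ ∀ v : Fin n → ℝ, (M ^ k *ᵥ v) ⬝ᵥ (M ^ k *ᵥ v) ≤ (1 / 2) * (v ⬝ᵥ v) := by
  rcases isEmpty_or_nonempty (Fin n) with hn | hn
  · exact ⟨1, one_pos, fun v => by simp [dotProduct]⟩
  obtain ⟨k, hk0, hk⟩ := exists_norm_pow_lt_of_spectrum (M.map (algebraMap ℝ ℂ)) h
    (by norm_num : (0 : ℝ) < 1 / 2)
  refine ⟨k, hk0, fun v => ?_⟩
  have hnorm : ∀ x : Fin n → ℝ,
      ‖(WithLp.toLp 2 (fun i => (x i : ℂ)) : EuclideanSpace ℂ (Fin n))‖ ^ 2 = x ⬝ᵥ x := by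
    intro x
    rw [EuclideanSpace.norm_sq_eq]
    simp [dotProduct, sq]
  have hmap : (M.map (algebraMap ℝ ℂ)) ^ k *ᵥ (fun i => (v i : ℂ)) =
      fun i => (((M ^ k) *ᵥ v) i : ℂ) := by
    have : (M.map (algebraMap ℝ ℂ)) ^ k = (M ^ k).map (algebraMap ℝ ℂ) :=
      (map_pow (algebraMap ℝ ℂ).mapMatrix M k).symm
    rw [this]
    ext i
    simp [mulVec, dotProduct]
  have h1 := l2_opNorm_mulVec ((M.map (algebraMap ℝ ℂ)) ^ k)
    (WithLp.toLp 2 (fun i => (v i : ℂ)) : EuclideanSpace ℂ (Fin n))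
  have h2 : ‖(WithLp.toLp 2 (fun i => (((M ^ k) *ᵥ v) i : ℂ)) : EuclideanSpace ℂ (Fin n))‖ ≤
      (1 / 2) * ‖(WithLp.toLp 2 (fun i => (v i : ℂ)) : EuclideanSpace ℂ (Fin n))‖ := by
    rw [← hmap]
    exact h1.trans (mul_le_mul_of_nonneg_right hk.le (norm_nonneg _))
  rw [← hnorm, ← hnorm]
  nlinarith [norm_nonneg (WithLp.toLp 2 (fun i => (((M ^ k) *ᵥ v) i : ℂ)) : EuclideanSpace ℂ (Fin n)),
    norm_nonneg (WithLp.toLp 2 (fun i => (v i : ℂ)) : EuclideanSpace ℂ (Fin n))]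

/-- Lyapunov's theorem: a Hurwitz matrix admits a quadratic Lyapunov function. -/
theorem IsHurwitz.exists_lyapunov {n : ℕ} {A : Matrix (Fin n) (Fin n) ℝ} (hA : IsHurwitz A) :
    ∃ P : Matrix (Fin n) (Fin n) ℝ, P.PosDef ∧ ∃ α > 0, ∀ y : Fin n → ℝ,
      y ⬝ᵥ (P *ᵥ (A *ᵥ y)) ≤ -α * (y ⬝ᵥ y) := by
  set φ := (algebraMap ℝ ℂ).mapMatrix (m := Fin n) with hφ
  have hu : IsUnit (1 - A) := by
    rw [isUnit_iff_isUnit_det]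
    have h1 : (1 : ℂ) ∉ spectrum ℂ (A.map (algebraMap ℝ ℂ)) := fun h => by
      have := hA 1 h
      norm_num at this
    rw [spectrum.notMem_iff, map_one] at h1
    have h2 : (1 : Matrix (Fin n) (Fin n) ℂ) - A.map (algebraMap ℝ ℂ) = φ (1 - A) := by
      rw [map_sub, map_one]; rfl
    rw [h2, isUnit_iff_isUnit_det, ← RingHom.map_det, isUnit_iff_ne_zero] at h1
    rw [isUnit_iff_ne_zero]
    exact fun h => h1 (by rw [h, map_zero])
  have hud := (isUnit_iff_isUnit_det _).1 hu
  set b := (1 - A)⁻¹ with hb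
  have hb1 : (1 - A) * b = 1 := mul_nonsing_inv _ hud
  have hb2 : b * (1 - A) = 1 := nonsing_inv_mul _ hud
  set M := (1 + A) * b with hM
  have hspec : ∀ μ ∈ spectrum ℂ (M.map (algebraMap ℝ ℂ)), ‖μ‖ < 1 := by
    intro μ hμ
    have e : M.map (algebraMap ℝ ℂ) = (1 + A.map (algebraMap ℝ ℂ)) * φ b := by
      change φ M = (1 + φ A) * φ b
      rw [hM, map_mul, map_add, map_one]
    rw [e] at hμ
    refine norm_lt_one_of_mem_spectrum_cayley ?_ ?_ hA hμ
    · change (1 - φ A) * φ b = 1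
      rw [← map_one φ, ← map_sub, ← map_mul, hb1]
    · change φ b * (1 - φ A) = 1
      rw [← map_one φ, ← map_sub, ← map_mul, hb2]
  obtain ⟨k, hk0, hk⟩ := exists_pow_dotProduct_le M hspec
  -- A truncation of the series solving the discrete Lyapunov equation. The difference along `M`
  -- telescopes to `|M ^ k v|² - |v|²`, which the choice of `k` already makes at most `-|v|² / 2`.
  set P := ∑ j ∈ Finset.range k, ((M ^ j)ᵀ * M ^ j) with hP
  have hPxy : ∀ x y : Fin n → ℝ,
      x ⬝ᵥ (P *ᵥ y) = ∑ j ∈ Finset.range k, (M ^ j *ᵥ x) ⬝ᵥ (M ^ j *ᵥ y) := by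
    intro x y
    rw [hP, sum_mulVec, dotProduct_sum]
    refine Finset.sum_congr rfl fun j _ => ?_
    rw [← mulVec_mulVec, dotProduct_mulVec, vecMul_transpose]
  have hnn : ∀ x : Fin n → ℝ, 0 ≤ x ⬝ᵥ x := fun x => by
    simpa using dotProduct_star_self_nonneg x
  have hPs : Pᵀ = P := by
    rw [hP, transpose_sum]
    exact Finset.sum_congr rfl fun j _ => by rw [transpose_mul, transpose_transpose]
  refine ⟨P, .of_dotProduct_mulVec_pos ?_ fun x hx => ?_, ?_⟩
  · rw [IsHermitian, conjTranspose_eq_transpose_of_trivial, hPs]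
  · rw [star_trivial, hPxy]
    refine Finset.sum_pos' (fun j _ => hnn _) ⟨0, Finset.mem_range.2 hk0, ?_⟩
    simpa using dotProduct_star_self_pos_iff.2 hx
  · have hG : ((1 - A)ᵀ * (1 - A)).PosDef := by
      refine .of_dotProduct_mulVec_pos ?_ fun x hx => ?_
      · rw [IsHermitian, conjTranspose_eq_transpose_of_trivial, transpose_mul, transpose_transpose]
      · rw [star_trivial, ← mulVec_mulVec, dotProduct_mulVec, vecMul_transpose]
        have hne : (1 - A) *ᵥ x ≠ 0 := fun h => hx (by
          have := congrArg (b *ᵥ ·) h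
          simpa [mulVec_mulVec, hb2] using this)
        simpa using dotProduct_star_self_pos_iff.2 hne
    obtain ⟨ε, hε, hεb⟩ := exists_pos_mul_dotProduct_le hG
    refine ⟨ε / 8, by positivity, fun y => ?_⟩
    -- Then `M v = (1 + A) y`, and polarization turns the discrete decrease into `4 y ⬝ᵥ P A y`;
    -- with the factor `1/2` above this explains `ε / 8`.
    set v := (1 - A) *ᵥ y with hv
    have hMv : M *ᵥ v = (1 + A) *ᵥ y := by
      rw [hv, mulVec_mulVec, hM, Matrix.mul_assoc, hb2, Matrix.mul_one]
    have htel : (M *ᵥ v) ⬝ᵥ (P *ᵥ (M *ᵥ v)) - v ⬝ᵥ (P *ᵥ v) =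
        (M ^ k *ᵥ v) ⬝ᵥ (M ^ k *ᵥ v) - v ⬝ᵥ v := by
      rw [hPxy, hPxy, ← Finset.sum_sub_distrib]
      have := Finset.sum_range_sub (fun j => (M ^ j *ᵥ v) ⬝ᵥ (M ^ j *ᵥ v)) k
      simp only [pow_zero, one_mulVec] at this
      rw [← this]
      refine Finset.sum_congr rfl fun j _ => ?_
      rw [mulVec_mulVec, ← pow_succ]
    have hsym : (A *ᵥ y) ⬝ᵥ (P *ᵥ y) = y ⬝ᵥ (P *ᵥ (A *ᵥ y)) := by
      rw [← dotProduct_transpose_mulVec, hPs]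
    have h4 : (M *ᵥ v) ⬝ᵥ (P *ᵥ (M *ᵥ v)) - v ⬝ᵥ (P *ᵥ v) = 4 * (y ⬝ᵥ (P *ᵥ (A *ᵥ y))) := by
      rw [hMv, hv]
      simp only [add_mulVec, sub_mulVec, one_mulVec, mulVec_add, mulVec_sub, add_dotProduct,
        sub_dotProduct, dotProduct_add, dotProduct_sub, hsym]
      ring
    have h5 := hεb y
    rw [← mulVec_mulVec, dotProduct_mulVec, vecMul_transpose, ← hv] at h5
    have h6 := hk v
    linarith

/-! ### Global solutions and Lyapunov's direct method. -/

section ODE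

variable {E : Type*} [NormedAddCommGroup E] [NormedSpace ℝ E]

/-- Since `G` is globally bounded and Lipschitz, the Picard–Lindelöf ball may be given radius `C *
T`, so the length of the interval is unrestricted. -/
theorem exists_solution_Icc [CompleteSpace E] {G : E → E} {K : NNReal} (hG : LipschitzWith K G)
    {C : NNReal} (hC : ∀ x, ‖G x‖ ≤ C) (x₀ : E) (T : NNReal) :
    ∃ x : ℝ → E, x 0 = x₀ ∧ ∀ t ∈ Icc (0 : ℝ) T, HasDerivWithinAt x (G (x t)) (Icc (0 : ℝ) T) t := by
  have hpl : IsPicardLindelof (fun _ => G) (tmin := 0) (tmax := (T : ℝ))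
      ⟨0, left_mem_Icc.2 T.2⟩ x₀ (C * T) 0 C K :=
    { lipschitzOnWith := fun _ _ => hG.lipschitzOnWith
      continuousOn := fun _ _ => continuousOn_const
      norm_le := fun _ _ x _ => hC x
      mul_max_le := by simp }
  exact hpl.exists_eq_forall_mem_Icc_hasDerivWithinAt₀

/-- A bounded Lipschitz vector field has a solution on `[0, ∞)` from every initial state. -/
theorem exists_solution_Ici [CompleteSpace E] {G : E → E} {K : NNReal} (hG : LipschitzWith K G)
    {C : NNReal} (hC : ∀ x, ‖G x‖ ≤ C) (x₀ : E) :
    ∃ x : ℝ → E, x 0 = x₀ ∧ ∀ t, 0 ≤ t → HasDerivWithinAt x (G (x t)) (Ici 0) t := by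
  choose α hα0 hα using fun k : ℕ => exists_solution_Icc hG hC x₀ (k : NNReal)
  simp only [NNReal.coe_natCast] at hα
  have heq : ∀ i j : ℕ, ∀ t : ℝ, 0 ≤ t → t ≤ i → t ≤ j → α i t = α j t := by
    have hder : ∀ i : ℕ, ∀ T : ℝ, T ≤ i → ∀ t ∈ Ico (0 : ℝ) T,
        HasDerivWithinAt (α i) (G (α i t)) (Ici t) t := by
      intro i T hT t ht
      have h1 := hα i t ⟨ht.1, ht.2.le.trans hT⟩
      refine HasDerivWithinAt.mono_of_mem_nhdsWithin (h1.mono (Icc_subset_Icc ht.1 hT)) ?_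
      exact Icc_mem_nhdsGE ht.2
    have hcont : ∀ i : ℕ, ∀ T : ℝ, T ≤ i → ContinuousOn (α i) (Icc 0 T) := fun i T hT t ht =>
      ((hα i t ⟨ht.1, ht.2.trans hT⟩).continuousWithinAt).mono (Icc_subset_Icc le_rfl hT)
    intro i j t ht hi hj
    exact ODE_solution_unique (v := fun _ => G) (fun _ => hG) (hcont i t hi) (hder i t hi)
      (hcont j t hj) (hder j t hj) ((hα0 i).trans (hα0 j).symm) (right_mem_Icc.2 ht)
  refine ⟨fun t => α ⌈t⌉₊ t, ?_, fun t ht => ?_⟩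
  · simpa using hα0 _
  -- The extra `1` keeps `t` strictly below `N`, so `[0, N]` is a neighbourhood of `t` within `[0,
  -- ∞)`.
  · set N := ⌈t⌉₊ + 1 with hN
    have htN : t < N := by
      rw [hN]; push_cast
      linarith [Nat.le_ceil t]
    have hxN : ∀ s ∈ Icc (0 : ℝ) N, α ⌈s⌉₊ s = α N s := fun s hs =>
      heq _ _ s hs.1 (Nat.le_ceil s) hs.2
    have h1 := (hα N t ⟨ht, htN.le⟩).congr (f₁ := fun t => α ⌈t⌉₊ t) hxN (hxN t ⟨ht, htN.le⟩)
    rw [← hxN t ⟨ht, htN.le⟩] at h1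
    refine h1.mono_of_mem_nhdsWithin ?_
    have : Icc (0 : ℝ) N = Ici 0 ∩ Iic (N : ℝ) := rfl
    rw [this]
    exact Filter.inter_mem self_mem_nhdsWithin (mem_nhdsWithin_of_mem_nhds (Iic_mem_nhds htN))

/-- A vector field that is Lipschitz near `p` agrees near `p` with a bounded Lipschitz one. -/
theorem exists_bounded_lipschitz_extension [FiniteDimensional ℝ E] {F : E → E} {p : E} {R : ℝ}
    (hR : 0 < R) {K : NNReal} (hF : LipschitzOnWith K F (Metric.closedBall p R)) :
    ∃ G : E → E, ∃ K' C : NNReal, LipschitzWith K' G ∧ (∀ x, ‖G x‖ ≤ C) ∧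
      ∃ s > 0, s ≤ R ∧ ∀ x ∈ Metric.closedBall p s, G x = F x := by
  set e := (Module.finBasis ℝ E).equivFunL with he
  -- Clipping coordinates at `a` is a Lipschitz retraction of `E` into the ball of radius `R`;
  -- precomposing `F` with it gives the extension.
  set a : ℝ := R / (‖(e.symm : (Fin (Module.finrank ℝ E) → ℝ) →L[ℝ] E)‖ + 1) with ha
  have ha0 : 0 < a := by positivity
  set clip : (Fin (Module.finrank ℝ E) → ℝ) → (Fin (Module.finrank ℝ E) → ℝ) :=
    fun y i => max (-a) (min a (y i)) with hclip
  have hclipL : LipschitzWith 1 clip := by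
    refine LipschitzWith.of_dist_le_mul fun x y => ?_
    rw [NNReal.coe_one, one_mul, dist_pi_le_iff dist_nonneg]
    intro i
    have h : LipschitzWith 1 fun t : ℝ => max (-a) (min a t) :=
      (LipschitzWith.id.const_min a).const_max (-a)
    have := h.dist_le_mul (x i) (y i)
    rw [NNReal.coe_one, one_mul] at this
    exact this.trans (dist_le_pi_dist x y i)
  have hclipB : ∀ y, ‖clip y‖ ≤ a := by
    intro y
    rw [pi_norm_le_iff_of_nonneg ha0.le]
    intro i
    rw [Real.norm_eq_abs, abs_le]
    exact ⟨le_max_left _ _, max_le (by linarith) (min_le_left _ _)⟩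
  set π : E → E := fun x => p + e.symm (clip (e (x - p))) with hπ
  obtain ⟨Kπ, hπL⟩ : ∃ Kπ, LipschitzWith Kπ π := by
    refine ⟨_, (LipschitzWith.const p).add (((e.symm : (Fin (Module.finrank ℝ E) → ℝ) →L[ℝ] E).lipschitz.comp hclipL).comp
      ((e : E →L[ℝ] (Fin (Module.finrank ℝ E) → ℝ)).lipschitz.comp (LipschitzWith.id.sub (LipschitzWith.const p))))⟩
  have hπB : ∀ x, π x ∈ Metric.closedBall p R := by
    intro x
    rw [Metric.mem_closedBall, dist_eq_norm]
    have h1 : ‖π x - p‖ ≤ ‖(e.symm : (Fin (Module.finrank ℝ E) → ℝ) →L[ℝ] E)‖ * ‖clip (e (x - p))‖ := by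
      simp only [hπ, add_sub_cancel_left]
      exact (e.symm : (Fin (Module.finrank ℝ E) → ℝ) →L[ℝ] E).le_opNorm _
    have h2 : ‖(e.symm : (Fin (Module.finrank ℝ E) → ℝ) →L[ℝ] E)‖ * ‖clip (e (x - p))‖ ≤ (‖(e.symm : (Fin (Module.finrank ℝ E) → ℝ) →L[ℝ] E)‖ + 1) * a := by
      have := hclipB (e (x - p))
      have := norm_nonneg (e.symm : (Fin (Module.finrank ℝ E) → ℝ) →L[ℝ] E)
      gcongr
      linarith
    have h3 : (‖(e.symm : (Fin (Module.finrank ℝ E) → ℝ) →L[ℝ] E)‖ + 1) * a = R := by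
      rw [ha]; field_simp
    linarith
  refine ⟨F ∘ π, K * Kπ, ‖F p‖₊ + K * R.toNNReal, ?_, fun x => ?_,
    min R (a / (‖(e : E →L[ℝ] (Fin (Module.finrank ℝ E) → ℝ))‖ + 1)), by positivity, min_le_left _ _, fun x hx => ?_⟩
  · have := hF.comp (hπL.lipschitzOnWith (s := univ)) fun x _ => hπB x
    exact lipschitzOnWith_univ.1 this
  · have h1 := hF.dist_le_mul _ (hπB x) p (Metric.mem_closedBall_self hR.le)
    have h2 : (K : ℝ) * dist (π x) p ≤ K * R := by
      have := hπB x
      rw [Metric.mem_closedBall] at this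
      gcongr
    rw [dist_eq_norm] at h1
    have h3 := norm_le_norm_add_norm_sub' (F (π x)) (F p)
    simp only [Function.comp_apply, NNReal.coe_add, NNReal.coe_mul, coe_nnnorm,
      Real.coe_toNNReal _ hR.le]
    linarith
  · have hx' : ‖x - p‖ ≤ a / (‖(e : E →L[ℝ] (Fin (Module.finrank ℝ E) → ℝ))‖ + 1) := by
      rw [← dist_eq_norm]
      exact (Metric.mem_closedBall.1 hx).trans (min_le_right _ _)
    have h1 : ‖e (x - p)‖ ≤ a := by
      have h2 := (e : E →L[ℝ] (Fin (Module.finrank ℝ E) → ℝ)).le_opNorm (x - p)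
      rw [le_div_iff₀ (by positivity)] at hx'
      have := norm_nonneg (x - p)
      have h3 : ‖e (x - p)‖ ≤ ‖(e : E →L[ℝ] (Fin (Module.finrank ℝ E) → ℝ))‖ * ‖x - p‖ := h2
      linarith
    have h2 : clip (e (x - p)) = e (x - p) := by
      ext i
      have := (norm_le_pi_norm (e (x - p)) i).trans h1
      rw [Real.norm_eq_abs, abs_le] at this
      simp only [hclip]
      rw [min_eq_right this.2, max_eq_right this.1]
    have h3 : π x = x := by
      simp only [hπ]
      rw [h2, e.symm_apply_apply, add_sub_cancel]
    rw [Function.comp_apply, h3]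

/-- A comparison argument: the Lyapunov function can never cross the decaying exponential. At a
touching time its value is below `c * s ^ 2`, so the state lies in the ball where the decrease is
known, and no separate invariance argument is needed. -/
theorem lyapunov_decay {B : E →L[ℝ] E →L[ℝ] ℝ} (hsymm : ∀ x y, B x y = B y x) {c : ℝ}
    (hpos : ∀ v, c * ‖v‖ ^ 2 ≤ B v v) {G : E → E} {p : E} {s lam : ℝ} (hs : 0 < s) (hc : 0 < c)
    (hlam : 0 < lam) (hdec : ∀ x ∈ Metric.closedBall p s, B (x - p) (G x) ≤ -lam * ‖x - p‖ ^ 2)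
    {x : ℝ → E} (hx : ∀ t, 0 ≤ t → HasDerivWithinAt x (G (x t)) (Ici 0) t)
    (h0 : B (x 0 - p) (x 0 - p) < c * s ^ 2) {t : ℝ} (ht : 0 ≤ t) :
    B (x t - p) (x t - p) ≤
      B (x 0 - p) (x 0 - p) * Real.exp (-(lam / (‖B‖ + 1)) * t) := by
  set μ := lam / (‖B‖ + 1) with hμ
  set V₀ := B (x 0 - p) (x 0 - p) with hV₀
  have hμ0 : 0 < μ := by positivity
  have hnn : ∀ v, 0 ≤ B v v := fun v => le_trans (by positivity) (hpos v)
  have hup : ∀ v, B v v ≤ ‖B‖ * ‖v‖ ^ 2 := fun v => by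
    have := B.le_opNorm₂ v v
    rw [Real.norm_eq_abs] at this
    nlinarith [le_abs_self (B v v)]
  -- The excess `e` keeps the barrier positive, hence the state away from `p` when they touch.
  -- Strictness there comes from the factor `2` in the derivative of the quadratic form; `e` is sent
  -- to `0` at the end.
  have main : ∀ e > 0, V₀ + e < c * s ^ 2 →
      B (x t - p) (x t - p) ≤ (V₀ + e) * Real.exp (-μ * t) := by
    intro e he hes
    have hder : ∀ t, 0 ≤ t → HasDerivWithinAt (fun t => B (x t - p) (x t - p))
        (2 * B (x t - p) (G (x t))) (Ici 0) t := by
      intro t ht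
      have h1 := (hx t ht).sub_const p
      have h2 := (B.hasFDerivAt (x := x t - p)).comp_hasDerivWithinAt t h1
      have h3 := h2.clm_apply h1
      convert! h3 using 1
      rw [hsymm (G (x t)), Function.comp_apply]; ring
    refine image_le_of_deriv_right_lt_deriv_boundary (a := 0) (b := t)
      (f := fun t => B (x t - p) (x t - p)) (f' := fun t => 2 * B (x t - p) (G (x t)))
      (B := fun t => (V₀ + e) * Real.exp (-μ * t))
      (B' := fun t => (V₀ + e) * (Real.exp (-μ * t) * -μ))
      (fun τ hτ => (hder τ hτ.1).continuousWithinAt.mono Icc_subset_Ici_self)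
      (fun τ hτ => (hder τ hτ.1).mono (Ici_subset_Ici.2 hτ.1)) ?_ ?_ ?_ (right_mem_Icc.2 ht)
    · simp only [mul_zero, Real.exp_zero, mul_one]
      linarith
    · intro τ
      have : HasDerivAt (fun t => -μ * t) (-μ) τ := by simpa using (hasDerivAt_id τ).const_mul (-μ)
      exact (this.exp).const_mul _
    · intro τ hτ heq
      have hpos' : 0 < (V₀ + e) * Real.exp (-μ * τ) :=
        mul_pos (by linarith [hnn (x 0 - p)]) (Real.exp_pos _)
      have hexp : Real.exp (-μ * τ) ≤ 1 := by
        rw [Real.exp_le_one_iff]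
        nlinarith [hτ.1]
      have hle : B (x τ - p) (x τ - p) < c * s ^ 2 := by
        have : (V₀ + e) * Real.exp (-μ * τ) ≤ (V₀ + e) * 1 :=
          mul_le_mul_of_nonneg_left hexp (by linarith [hnn (x 0 - p)])
        linarith
      have hball : x τ ∈ Metric.closedBall p s := by
        rw [Metric.mem_closedBall, dist_eq_norm]
        have := (hpos (x τ - p)).trans hle.le
        exact abs_le_of_sq_le_sq' (le_of_mul_le_mul_left this hc) hs.le |>.2
      have h1 := hdec _ hball
      have h2 := hup (x τ - p)
      have h3 : 0 < ‖x τ - p‖ ^ 2 := by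
        by_contra hcon
        have : ‖x τ - p‖ ^ 2 = 0 := le_antisymm (not_lt.1 hcon) (sq_nonneg _)
        rw [this, mul_zero] at h2
        linarith
      have h4 : μ * B (x τ - p) (x τ - p) ≤ lam * ‖x τ - p‖ ^ 2 := by
        have : μ * B (x τ - p) (x τ - p) ≤ μ * ((‖B‖ + 1) * ‖x τ - p‖ ^ 2) :=
          mul_le_mul_of_nonneg_left (by nlinarith) hμ0.le
        have h5 : μ * ((‖B‖ + 1) * ‖x τ - p‖ ^ 2) = lam * ‖x τ - p‖ ^ 2 := by
          rw [hμ]; field_simp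
        linarith
      have h5 : 0 < lam * ‖x τ - p‖ ^ 2 := by positivity
      have : (V₀ + e) * (Real.exp (-μ * τ) * -μ) = -(μ * B (x τ - p) (x τ - p)) := by
        rw [heq]; ring
      rw [this]
      linarith
  have hexp : Real.exp (-μ * t) ≤ 1 := by
    rw [Real.exp_le_one_iff]
    nlinarith
  refine le_of_forall_pos_le_add fun e he => ?_
  have hmin : 0 < min e ((c * s ^ 2 - V₀) / 2) := lt_min he (by linarith)
  have h1 := main _ hmin (by
    have := min_le_right e ((c * s ^ 2 - V₀) / 2)
    linarith)
  have h2 := mul_le_mul_of_nonneg_left hexp hmin.le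
  have h3 := min_le_left e ((c * s ^ 2 - V₀) / 2)
  nlinarith

/-- Exponential stability from a quadratic Lyapunov function. -/
theorem isLocallyExpStable_of_lyapunov [FiniteDimensional ℝ E] {F : E → E} {dom : Set E} {p : E}
    {B : E →L[ℝ] E →L[ℝ] ℝ} (hsymm : ∀ x y, B x y = B y x) {c : ℝ} (hc : 0 < c)
    (hpos : ∀ v, c * ‖v‖ ^ 2 ≤ B v v) {R : ℝ} (hR : 0 < R)
    (hdom : Metric.closedBall p R ⊆ dom) {K : NNReal}
    (hF : LipschitzOnWith K F (Metric.closedBall p R)) {lam : ℝ} (hlam : 0 < lam)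
    (hdec : ∀ x ∈ Metric.closedBall p R, B (x - p) (F x) ≤ -lam * ‖x - p‖ ^ 2) :
    IsLocallyExpStable F dom p := by
  have : CompleteSpace E := FiniteDimensional.complete ℝ E
  obtain ⟨G, K', C, hGL, hGC, s, hs, hsR, hGF⟩ := exists_bounded_lipschitz_extension hR hF
  have hball : Metric.closedBall p s ⊆ Metric.closedBall p R := Metric.closedBall_subset_closedBall hsR
  have hup : ∀ v, B v v ≤ (‖B‖ + 1) * ‖v‖ ^ 2 := fun v => by
    have := B.le_opNorm₂ v v
    rw [Real.norm_eq_abs] at this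
    nlinarith [le_abs_self (B v v), sq_nonneg ‖v‖]
  set b := ‖B‖ + 1 with hb
  have hb0 : 0 < b := by positivity
  have hδ : ∀ x₀, ‖x₀ - p‖ < s * Real.sqrt (c / b) → B (x₀ - p) (x₀ - p) < c * s ^ 2 := by
    intro x₀ h
    have h1 : ‖x₀ - p‖ ^ 2 < (s * Real.sqrt (c / b)) ^ 2 := by
      gcongr
    rw [mul_pow, Real.sq_sqrt (by positivity)] at h1
    have h2 := (hup (x₀ - p)).trans_lt (mul_lt_mul_of_pos_left h1 hb0)
    have h3 : b * (s ^ 2 * (c / b)) = c * s ^ 2 := by field_simp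
    linarith
  refine ⟨Real.sqrt (b / c), by positivity, lam / b / 2, by positivity, s * Real.sqrt (c / b),
    by positivity, fun x₀ hx₀ => ⟨?_, ?_⟩⟩
  -- Solve for the extension `G`; the decay estimate confines the solution to the ball where `G =
  -- F`.
  · obtain ⟨x, hx0, hx⟩ := exists_solution_Ici hGL hGC x₀
    refine ⟨x, fun t ht => ?_, hx0⟩
    have h0 : B (x 0 - p) (x 0 - p) < c * s ^ 2 := hx0 ▸ hδ x₀ hx₀
    have h1 := lyapunov_decay hsymm hpos hs hc hlam
      (fun y hy => by rw [hGF y hy]; exact hdec y (hball hy)) hx h0 ht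
    have h2 : Real.exp (-(lam / b) * t) ≤ 1 := by
      rw [Real.exp_le_one_iff]
      have : 0 ≤ lam / b * t := by positivity
      linarith
    have h3 : B (x t - p) (x t - p) ≤ B (x 0 - p) (x 0 - p) := by
      have : 0 ≤ B (x 0 - p) (x 0 - p) := le_trans (by positivity) (hpos _)
      nlinarith
    have hmem : x t ∈ Metric.closedBall p s := by
      rw [Metric.mem_closedBall, dist_eq_norm]
      have := (hpos (x t - p)).trans (h3.trans h0.le)
      exact abs_le_of_sq_le_sq' (le_of_mul_le_mul_left this hc) hs.le |>.2
    refine ⟨hdom (hball hmem), ?_⟩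
    rw [← hGF _ hmem]
    exact hx t ht
  -- The decay estimate applies directly to any solution for `F`, so uniqueness of solutions is not
  -- used.
  · intro x hx hx0 t ht
    have h1 := lyapunov_decay hsymm hpos hs hc hlam (fun y hy => hdec y (hball hy))
      (fun t ht => (hx t ht).2) (hx0 ▸ hδ x₀ hx₀) ht
    rw [hx0] at h1
    have h2 := (hpos (x t - p)).trans
      (h1.trans (mul_le_mul_of_nonneg_right (hup (x₀ - p)) (Real.exp_pos _).le))
    refine abs_le_of_sq_le_sq' ?_ (by positivity) |>.2
    rw [mul_pow, mul_pow, Real.sq_sqrt (by positivity), ← Real.exp_nat_mul]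
    have h3 : ((2 : ℕ) : ℝ) * (-(lam / b / 2) * t) = -(lam / b) * t := by push_cast; ring
    rw [h3, div_mul_eq_mul_div, div_mul_eq_mul_div, le_div_iff₀ hc]
    linarith

end ODE

/-! ### Two-time-scale stability. -/

section SingularPerturbation

/-- Here `a` and `y` are the sizes of the fast and slow errors. Young's inequality gives half of `ε
y²` to the mixed term; the resulting multiple of `a²` carries a factor `τ⁻¹` and fits into half of
`α a²` once `τ` is large. -/
theorem timescale_separation {α ε L M : ℝ} (hα : 0 < α) (hε : 0 < ε) (hM : 0 ≤ M)
    {τ : ℝ} (hτ : 2 / α * (M + (L + M) ^ 2 / (2 * ε)) + 1 ≤ τ) (a y : ℝ) :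
    -α * a ^ 2 + τ⁻¹ * (M * (a * (y + a)) + (-ε * y ^ 2 + L * (y * a))) ≤
      -(α / 2) * a ^ 2 - τ⁻¹ * (ε / 2) * y ^ 2 := by
  have hτ0 : 0 < τ := by
    have : 0 ≤ 2 / α * (M + (L + M) ^ 2 / (2 * ε)) := by positivity
    linarith
  have h1 : M + (L + M) ^ 2 / (2 * ε) ≤ α / 2 * τ := by
    have h2 : 2 / α * (M + (L + M) ^ 2 / (2 * ε)) ≤ τ := by linarith
    rw [div_mul_eq_mul_div, div_le_iff₀ hα] at h2
    linarith
  have h3 : (L + M) * (y * a) ≤ ε / 2 * y ^ 2 + (L + M) ^ 2 / (2 * ε) * a ^ 2 := by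
    have : ε / 2 * y ^ 2 + (L + M) ^ 2 / (2 * ε) * a ^ 2 - (L + M) * (y * a) =
        (ε * y - (L + M) * a) ^ 2 / (2 * ε) := by field_simp; ring
    have h4 : 0 ≤ (ε * y - (L + M) * a) ^ 2 / (2 * ε) := by positivity
    linarith
  have h5 : M * (a * (y + a)) + (-ε * y ^ 2 + L * (y * a)) ≤
      α / 2 * τ * a ^ 2 - ε / 2 * y ^ 2 := by
    nlinarith [mul_le_mul_of_nonneg_right h1 (sq_nonneg a)]
  have h6 := mul_le_mul_of_nonneg_left h5 (inv_nonneg.2 hτ0.le)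
  have h7 : τ⁻¹ * (α / 2 * τ * a ^ 2 - ε / 2 * y ^ 2) = α / 2 * a ^ 2 - τ⁻¹ * (ε / 2) * y ^ 2 := by
    field_simp
  rw [h7] at h6
  linarith

variable {X H : Type*} [NormedAddCommGroup X] [NormedSpace ℝ X]
  [NormedAddCommGroup H] [NormedSpace ℝ H]

theorem prod_norm_sq_le (Γ : H →L[ℝ] X) (v : X × H) :
    ‖v‖ ^ 2 ≤ 2 * (‖Γ‖ + 1) ^ 2 * (‖v.1 - Γ v.2‖ ^ 2 + ‖v.2‖ ^ 2) := by
  have h1 : ‖v.1‖ ≤ ‖v.1 - Γ v.2‖ + ‖Γ‖ * ‖v.2‖ := by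
    have := norm_add_le (v.1 - Γ v.2) (Γ v.2)
    rw [sub_add_cancel] at this
    linarith [Γ.le_opNorm v.2]
  have h2 : ‖v‖ ≤ (‖Γ‖ + 1) * (‖v.1 - Γ v.2‖ + ‖v.2‖) := by
    rw [Prod.norm_def]
    have := norm_nonneg Γ
    have := norm_nonneg (v.1 - Γ v.2)
    have := norm_nonneg v.2
    refine max_le ?_ ?_ <;> nlinarith [mul_nonneg ‹0 ≤ ‖Γ‖› ‹0 ≤ ‖v.1 - Γ v.2‖›,
      mul_nonneg ‹0 ≤ ‖Γ‖› ‹0 ≤ ‖v.2‖›]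
  calc ‖v‖ ^ 2 ≤ ((‖Γ‖ + 1) * (‖v.1 - Γ v.2‖ + ‖v.2‖)) ^ 2 := by gcongr
    _ = (‖Γ‖ + 1) ^ 2 * (‖v.1 - Γ v.2‖ + ‖v.2‖) ^ 2 := mul_pow _ _ _
    _ ≤ (‖Γ‖ + 1) ^ 2 * (2 * (‖v.1 - Γ v.2‖ ^ 2 + ‖v.2‖ ^ 2)) := by
      gcongr
      exact add_sq_le
    _ = _ := by ring

/-- Stability of a two-time-scale interconnection: a fast linear stable state `x` and a slow
state `η` whose reduced dynamics are strongly dissipative. The threshold on `τ` depends only on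
the constants, not on the equilibrium. -/
theorem exists_timescale_stable [FiniteDimensional ℝ X] [FiniteDimensional ℝ H]
    (A : X →L[ℝ] X) (Γ : H →L[ℝ] X)
    (BX : X →L[ℝ] X →L[ℝ] ℝ) (BH : H →L[ℝ] H →L[ℝ] ℝ)
    (hsX : ∀ x y, BX x y = BX y x) (hsH : ∀ x y, BH x y = BH y x)
    {cX cH α ε L M : ℝ} (hcX : 0 < cX) (hcH : 0 < cH) (hα : 0 < α) (hε : 0 < ε) (hM : 0 ≤ M)
    (hX : ∀ x, cX * ‖x‖ ^ 2 ≤ BX x x) (hH : ∀ y, cH * ‖y‖ ^ 2 ≤ BH y y)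
    (hA : ∀ x, BX x (A x) ≤ -α * ‖x‖ ^ 2) :
    ∃ τ₀ > 0, ∀ τ : ℝ, τ₀ ≤ τ → ∀ (p : X × H) (F : X × H → X × H) (dom : Set (X × H)) (R : ℝ)
      (K : NNReal), 0 < R → Metric.closedBall p R ⊆ dom → LipschitzOnWith K F (Metric.closedBall p R) →
      (∀ ξ ∈ Metric.closedBall p R, ∃ a : X, a = (ξ - p).1 - Γ (ξ - p).2 ∧ (F ξ).1 = A a ∧
        ∃ Φ : H, (F ξ).2 = τ⁻¹ • Φ ∧
          BH (ξ - p).2 Φ ≤ -ε * ‖(ξ - p).2‖ ^ 2 + L * (‖(ξ - p).2‖ * ‖a‖) ∧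
          ‖Φ‖ ≤ M * (‖(ξ - p).2‖ + ‖a‖)) →
      IsLocallyExpStable F dom p := by
  set M' := ‖BX‖ * ‖Γ‖ * M with hM'
  have hM0 : 0 ≤ M' := by positivity
  refine ⟨2 / α * (M' + (L + M') ^ 2 / (2 * ε)) + 1, by positivity, ?_⟩
  intro τ hτ p F dom R K hR hdom hF hbd
  have hτ0 : 0 < τ := lt_of_lt_of_le (by positivity) hτ
  -- `D` measures the deviation of the fast state from its quasi-steady value, and the Lyapunov
  -- function is the sum of `BX` on this deviation and `BH` on the slow state.
  set D : X × H →L[ℝ] X := ContinuousLinearMap.fst ℝ X H - Γ.comp (ContinuousLinearMap.snd ℝ X H)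
    with hD
  set π := ContinuousLinearMap.snd ℝ X H
  set B : (X × H) →L[ℝ] (X × H) →L[ℝ] ℝ := BX.bilinearComp D D + BH.bilinearComp π π with hB
  have hBapp : ∀ v w, B v w = BX (v.1 - Γ v.2) (w.1 - Γ w.2) + BH v.2 w.2 := fun v w => rfl
  have hΓ0 : 0 < 2 * (‖Γ‖ + 1) ^ 2 := by positivity
  refine isLocallyExpStable_of_lyapunov (B := B) (c := min cX cH / (2 * (‖Γ‖ + 1) ^ 2))
    (lam := min (α / 2) (τ⁻¹ * (ε / 2)) / (2 * (‖Γ‖ + 1) ^ 2)) ?_ (by positivity) ?_ hR hdom hF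
    (by positivity) ?_
  · intro v w
    rw [hBapp, hBapp, hsX, hsH]
  · intro v
    rw [hBapp, div_mul_eq_mul_div, div_le_iff₀ hΓ0]
    have h1 := prod_norm_sq_le Γ v
    have h2 : min cX cH * (‖v.1 - Γ v.2‖ ^ 2 + ‖v.2‖ ^ 2) ≤
        BX (v.1 - Γ v.2) (v.1 - Γ v.2) + BH v.2 v.2 := by
      have e1 := mul_le_mul_of_nonneg_right (min_le_left cX cH) (sq_nonneg ‖v.1 - Γ v.2‖)
      have e2 := mul_le_mul_of_nonneg_right (min_le_right cX cH) (sq_nonneg ‖v.2‖)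
      linarith [hX (v.1 - Γ v.2), hH v.2]
    have h3 := mul_le_mul_of_nonneg_left h1 (le_min hcX.le hcH.le)
    have h4 := mul_le_mul_of_nonneg_right h2 hΓ0.le
    linarith
  · intro ξ hξ
    obtain ⟨a, ha, hF1, Φ, hF2, h1, h2⟩ := hbd ξ hξ
    rw [hBapp, ← ha, hF1, hF2, map_smul, map_smul, map_sub, map_smul, smul_eq_mul, smul_eq_mul]
    set y := (ξ - p).2 with hy
    -- The drift of the quasi-steady state, caused by the motion of the slow variable.
    have hΓ : -(BX a (Γ Φ)) ≤ M' * (‖a‖ * (‖y‖ + ‖a‖)) := by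
      have e1 := BX.le_opNorm₂ a (Γ Φ)
      rw [Real.norm_eq_abs] at e1
      have e2 := neg_le_abs (BX a (Γ Φ))
      have e3 : ‖Γ Φ‖ ≤ ‖Γ‖ * (M * (‖y‖ + ‖a‖)) :=
        (Γ.le_opNorm Φ).trans (mul_le_mul_of_nonneg_left h2 (norm_nonneg _))
      have e4 : ‖BX‖ * ‖a‖ * ‖Γ Φ‖ ≤ ‖BX‖ * ‖a‖ * (‖Γ‖ * (M * (‖y‖ + ‖a‖))) := by gcongr
      have e5 : ‖BX‖ * ‖a‖ * (‖Γ‖ * (M * (‖y‖ + ‖a‖))) = M' * (‖a‖ * (‖y‖ + ‖a‖)) := by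
        rw [hM']; ring
      linarith
    have h3 := timescale_separation hα hε hM0 hτ ‖a‖ ‖y‖
    have h4 := mul_le_mul_of_nonneg_left (add_le_add hΓ h1) (inv_nonneg.2 hτ0.le)
    have h5 := hA a
    have h6 := prod_norm_sq_le Γ (ξ - p)
    rw [← ha, ← hy] at h6
    set l := min (α / 2) (τ⁻¹ * (ε / 2)) with hl
    have hl0 : 0 < l := by positivity
    have h7 : l * (‖a‖ ^ 2 + ‖y‖ ^ 2) ≤ α / 2 * ‖a‖ ^ 2 + τ⁻¹ * (ε / 2) * ‖y‖ ^ 2 := by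
      have e1 := mul_le_mul_of_nonneg_right (min_le_left (α / 2) (τ⁻¹ * (ε / 2))) (sq_nonneg ‖a‖)
      have e2 := mul_le_mul_of_nonneg_right (min_le_right (α / 2) (τ⁻¹ * (ε / 2))) (sq_nonneg ‖y‖)
      linarith
    have h8 : l / (2 * (‖Γ‖ + 1) ^ 2) * ‖ξ - p‖ ^ 2 ≤ l * (‖a‖ ^ 2 + ‖y‖ ^ 2) := by
      rw [div_mul_eq_mul_div, div_le_iff₀ hΓ0]
      have := mul_le_mul_of_nonneg_left h6 hl0.le
      linarith
    linarith

end SingularPerturbation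

/-! ### Matrix forms and matrix maps on Euclidean spaces. -/

/-- The bilinear form `(x, y) ↦ (J x)ᵀ P (J y)`. -/
def matrixForm {V κ : Type*} [NormedAddCommGroup V] [NormedSpace ℝ V] [FiniteDimensional ℝ V]
    [Fintype κ] [DecidableEq κ] (J : V →ₗ[ℝ] κ → ℝ) (P : Matrix κ κ ℝ) : V →L[ℝ] V →L[ℝ] ℝ :=
  ((Matrix.toLinearMap₂' ℝ P).compl₁₂ J J).toContinuousBilinearMap

theorem matrixForm_apply {V κ : Type*} [NormedAddCommGroup V] [NormedSpace ℝ V]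
    [FiniteDimensional ℝ V] [Fintype κ] [DecidableEq κ] (J : V →ₗ[ℝ] κ → ℝ) (P : Matrix κ κ ℝ)
    (x y : V) : matrixForm J P x y = J x ⬝ᵥ (P *ᵥ J y) := by
  rw [matrixForm, LinearMap.toContinuousBilinearMap_apply, LinearMap.compl₁₂_apply,
    Matrix.toLinearMap₂'_apply']

theorem matrixForm_symm {V κ : Type*} [NormedAddCommGroup V] [NormedSpace ℝ V]
    [FiniteDimensional ℝ V] [Fintype κ] [DecidableEq κ] (J : V →ₗ[ℝ] κ → ℝ) {P : Matrix κ κ ℝ}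
    (hP : Pᵀ = P) (x y : V) : matrixForm J P x y = matrixForm J P y x := by
  rw [matrixForm_apply, matrixForm_apply, ← dotProduct_transpose_mulVec, hP]

theorem _root_.Matrix.PosDef.transpose_eq {κ : Type*} {P : Matrix κ κ ℝ} (hP : P.PosDef) :
    Pᵀ = P := by
  have := hP.isHermitian
  rwa [IsHermitian, conjTranspose_eq_transpose_of_trivial] at this

theorem euclidean_norm_sq {k : ℕ} (x : EuclideanSpace ℝ (Fin k)) :
    ‖x‖ ^ 2 = x.ofLp ⬝ᵥ x.ofLp := by
  rw [EuclideanSpace.norm_sq_eq]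
  simp [dotProduct, sq]

/-- The coordinates of a pair of Euclidean vectors. -/
def pairVec (q nc : ℕ) :
    EuclideanSpace ℝ (Fin q) × EuclideanSpace ℝ (Fin nc) →ₗ[ℝ] Fin q ⊕ Fin nc → ℝ where
  toFun η := Sum.elim η.1.ofLp η.2.ofLp
  map_add' η η' := by ext i; rcases i with i | i <;> rfl
  map_smul' c η := by ext i; rcases i with i | i <;> rfl

theorem pairVec_apply {q nc : ℕ} (η : EuclideanSpace ℝ (Fin q) × EuclideanSpace ℝ (Fin nc)) :
    pairVec q nc η = Sum.elim η.1.ofLp η.2.ofLp := rfl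

theorem norm_sq_le_pairVec {q nc : ℕ} (η : EuclideanSpace ℝ (Fin q) × EuclideanSpace ℝ (Fin nc)) :
    ‖η‖ ^ 2 ≤ pairVec q nc η ⬝ᵥ pairVec q nc η := by
  rw [pairVec_apply, sumElim_dotProduct, ← euclidean_norm_sq, ← euclidean_norm_sq, Prod.norm_def]
  rcases max_cases ‖η.1‖ ‖η.2‖ with ⟨h, -⟩ | ⟨h, -⟩ <;> rw [h] <;>
    nlinarith [sq_nonneg ‖η.1‖, sq_nonneg ‖η.2‖]

theorem exists_pos_le_matrixForm_pairVec {q nc : ℕ}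
    {P : Matrix (Fin q ⊕ Fin nc) (Fin q ⊕ Fin nc) ℝ} (hP : P.PosDef) :
    ∃ c > 0, ∀ η, c * ‖η‖ ^ 2 ≤ matrixForm (pairVec q nc) P η η := by
  obtain ⟨c, hc, h⟩ := exists_pos_mul_dotProduct_le hP
  refine ⟨c, hc, fun η => ?_⟩
  rw [matrixForm_apply]
  exact (mul_le_mul_of_nonneg_left (norm_sq_le_pairVec η) hc.le).trans (h _)

/-- The continuous linear map of Euclidean spaces given by a matrix. -/
abbrev mlin {k l : ℕ} (M : Matrix (Fin k) (Fin l) ℝ) :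
    EuclideanSpace ℝ (Fin l) →L[ℝ] EuclideanSpace ℝ (Fin k) :=
  (toEuclideanLin M).toContinuousLinearMap

theorem toEuclideanLin_eq_mlin {k l : ℕ} (M : Matrix (Fin k) (Fin l) ℝ)
    (x : EuclideanSpace ℝ (Fin l)) : toEuclideanLin M x = mlin M x := rfl

theorem ofLp_mlin {k l : ℕ} (M : Matrix (Fin k) (Fin l) ℝ)
    (x : EuclideanSpace ℝ (Fin l)) : (mlin M x).ofLp = M *ᵥ x.ofLp := rfl

theorem mlin_mul_apply {k l o : ℕ} (M : Matrix (Fin k) (Fin l) ℝ) (N : Matrix (Fin l) (Fin o) ℝ)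
    (x : EuclideanSpace ℝ (Fin o)) : mlin (M * N) x = mlin M (mlin N x) := by
  apply WithLp.ofLp_injective
  simp only [ofLp_mlin, mulVec_mulVec]

theorem inner_mlin {k l : ℕ} (M : Matrix (Fin k) (Fin l) ℝ) (x : EuclideanSpace ℝ (Fin k))
    (y : EuclideanSpace ℝ (Fin l)) : inner ℝ x (mlin M y) = inner ℝ (mlin Mᵀ x) y := by
  rw [EuclideanSpace.inner_eq_star_dotProduct, EuclideanSpace.inner_eq_star_dotProduct, ofLp_mlin,
    ofLp_mlin, star_trivial, star_trivial, dotProduct_transpose_mulVec, dotProduct_comm]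

/-! ### The closed loop in fast and slow coordinates, and the reduced dynamics. -/

namespace Data

variable {n m r nc nw q : ℕ} (S : Data n m r nc nw)

/-- The static feedback `η ↦ K₁ η₁ + K₂ η₂`. -/
def gain (K : Matrix (Fin m) (Fin q ⊕ Fin nc) ℝ) :
    EuclideanSpace ℝ (Fin q) × EuclideanSpace ℝ (Fin nc) →L[ℝ] EuclideanSpace ℝ (Fin m) :=
  (mlin K.toCols₁).coprod (mlin K.toCols₂)

theorem input_eq_gain (K : Matrix (Fin m) (Fin q ⊕ Fin nc) ℝ) (ξ : State n q nc) :
    input K ξ = gain K ξ.2 := rfl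

theorem ofLp_gain (K : Matrix (Fin m) (Fin q ⊕ Fin nc) ℝ)
    (η : EuclideanSpace ℝ (Fin q) × EuclideanSpace ℝ (Fin nc)) :
    (gain K η).ofLp = K *ᵥ pairVec q nc η := by
  conv_rhs => rw [← fromCols_toCols K, pairVec_apply, fromCols_mulVec]
  rfl

/-- Steady-state output for the constant input `u`. -/
def dcOutput (w : EuclideanSpace ℝ (Fin nw)) (u : EuclideanSpace ℝ (Fin m)) :
    EuclideanSpace ℝ (Fin r) :=
  mlin S.Gu u + mlin S.Gw w

/-- Steady state of the plant for the constant input `u`. -/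
def dcState (w : EuclideanSpace ℝ (Fin nw)) (u : EuclideanSpace ℝ (Fin m)) :
    EuclideanSpace ℝ (Fin n) :=
  -(mlin S.A⁻¹ (mlin S.B u + mlin S.Bw w))

/-- The controller dynamics before scaling by the time constants. -/
def slowField (Tz : Matrix (Fin r) (Fin q) ℝ) (Tu : Matrix (Fin m) (Fin q) ℝ)
    (w : EuclideanSpace ℝ (Fin nw)) (u : EuclideanSpace ℝ (Fin m)) (z : EuclideanSpace ℝ (Fin r)) :
    EuclideanSpace ℝ (Fin q) × EuclideanSpace ℝ (Fin nc) :=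
  (-(mlin Tuᵀ (gradient S.f₀ u) + mlin Tzᵀ (gradient S.g₀ z)), -S.violation w u z)

theorem closedLoop_snd (Tz : Matrix (Fin r) (Fin q) ℝ) (Tu : Matrix (Fin m) (Fin q) ℝ)
    (K : Matrix (Fin m) (Fin q ⊕ Fin nc) ℝ) (τ : ℝ) (w : EuclideanSpace ℝ (Fin nw))
    (ξ : State n q nc) :
    (S.closedLoop Tz Tu K τ τ w ξ).2 =
      τ⁻¹ • S.slowField Tz Tu w (gain K ξ.2) (S.output K w ξ) := by
  rw [slowField, Prod.smul_mk, smul_neg, smul_neg]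
  rfl

theorem closedLoop_fst (hA : IsUnit S.A.det) (Tz : Matrix (Fin r) (Fin q) ℝ)
    (Tu : Matrix (Fin m) (Fin q) ℝ)
    (K : Matrix (Fin m) (Fin q ⊕ Fin nc) ℝ) (τ : ℝ) (w : EuclideanSpace ℝ (Fin nw))
    (ξ : State n q nc) :
    (S.closedLoop Tz Tu K τ τ w ξ).1 = mlin S.A (ξ.1 - S.dcState w (gain K ξ.2)) := by
  rw [dcState, sub_neg_eq_add, map_add, ← mlin_mul_apply, mul_nonsing_inv _ hA]
  have h1 : ∀ x, mlin (1 : Matrix (Fin n) (Fin n) ℝ) x = x := fun x => by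
    apply WithLp.ofLp_injective
    rw [ofLp_mlin, one_mulVec]
  rw [h1, ← add_assoc]
  rfl

/-- Together with `closedLoop_fst` this shows that the plant affects the controller only through its
deviation from the quasi-steady state. -/
theorem output_eq (K : Matrix (Fin m) (Fin q ⊕ Fin nc) ℝ) (w : EuclideanSpace ℝ (Fin nw))
    (ξ : State n q nc) :
    S.output K w ξ =
      mlin S.C (ξ.1 - S.dcState w (gain K ξ.2)) + S.dcOutput w (gain K ξ.2) := by
  apply WithLp.ofLp_injective
  simp only [output, input_eq_gain, dcState, dcOutput, Gu, Gw, toEuclideanLin_eq_mlin,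
    WithLp.ofLp_add, WithLp.ofLp_sub, WithLp.ofLp_neg, ofLp_mlin, mulVec_add, mulVec_sub,
    mulVec_neg, add_mulVec, neg_mulVec, ← mulVec_mulVec]
  abel

theorem dcState_sub (w : EuclideanSpace ℝ (Fin nw)) (u u' : EuclideanSpace ℝ (Fin m)) :
    S.dcState w u - S.dcState w u' = -(mlin S.A⁻¹ (mlin S.B (u - u'))) := by
  simp only [dcState, map_add, map_sub]
  abel

theorem dcOutput_sub (w : EuclideanSpace ℝ (Fin nw)) (u u' : EuclideanSpace ℝ (Fin m)) :
    S.dcOutput w u - S.dcOutput w u' = mlin S.Gu (u - u') := by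
  simp only [dcOutput, map_sub]
  abel

variable {S} {Tz : Matrix (Fin r) (Fin q) ℝ} {Tu : Matrix (Fin m) (Fin q) ℝ}
  {Q₁ : Matrix (Fin m) (Fin m) ℝ} {Q₂ : Matrix (Fin r) (Fin r) ℝ}
  {Θ₁ : Matrix (Fin m ⊕ Fin m) (Fin m ⊕ Fin m) ℝ}
  {Θ₂ : Matrix (Fin r ⊕ Fin r) (Fin r ⊕ Fin r) ℝ} {ρ γ : ℝ}
  {Y : Matrix (Fin q ⊕ Fin nc) (Fin q ⊕ Fin nc) ℝ} {Z : Matrix (Fin m) (Fin q ⊕ Fin nc) ℝ}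
  {θ₁ θ₂ : ℝ} {ft : EuclideanSpace ℝ (Fin m) → ℝ} {gt : EuclideanSpace ℝ (Fin r) → ℝ}

/-- The reduced slow dynamics are strongly dissipative in the metric of `Y⁻¹`. -/
theorem SynthesisLMI.slowField_dissipation
    (h : S.SynthesisLMI Tz Tu Q₁ Q₂ Θ₁ Θ₂ ρ γ Y Z θ₁ θ₂)
    (hf : IsQuadraticSplit S.Uset S.f₀ ft Q₁) (hg : IsQuadraticSplit S.Zset S.g₀ gt Q₂)
    (hΘ₁ : IsSectorMultiplier (interior S.Uset) (gradient ft) Θ₁)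
    (hΘ₂ : IsSectorMultiplier (interior S.Zset) (gradient gt) Θ₂) :
    ∃ ε > 0, ∀ (w : EuclideanSpace ℝ (Fin nw))
      (η η' : EuclideanSpace ℝ (Fin q) × EuclideanSpace ℝ (Fin nc)),
      gain (Z * Y⁻¹) η ∈ interior S.Uset → gain (Z * Y⁻¹) η' ∈ interior S.Uset →
      S.dcOutput w (gain (Z * Y⁻¹) η) ∈ interior S.Zset →
      S.dcOutput w (gain (Z * Y⁻¹) η') ∈ interior S.Zset →
      matrixForm (pairVec q nc) Y⁻¹ (η - η')
        (S.slowField Tz Tu w (gain (Z * Y⁻¹) η) (S.dcOutput w (gain (Z * Y⁻¹) η)) -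
          S.slowField Tz Tu w (gain (Z * Y⁻¹) η') (S.dcOutput w (gain (Z * Y⁻¹) η'))) ≤
        -ε * ‖η - η'‖ ^ 2 := by
  obtain ⟨ε, hε, hd⟩ := SynthesisLMI.dissipation S h hΘ₁.symm hΘ₂.symm hΘ₁.nonsing hΘ₂.nonsing
    hΘ₁.upperLeft hΘ₂.upperLeft
  obtain ⟨hY, hθ₁, hθ₂, -⟩ := h
  have hYs : (Y⁻¹)ᵀ = Y⁻¹ := hY.inv.transpose_eq
  have hYY : (Y⁻¹ * Y⁻¹).PosDef := by
    refine .of_dotProduct_mulVec_pos ?_ fun x hx => ?_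
    · rw [IsHermitian, conjTranspose_eq_transpose_of_trivial, transpose_mul, hYs]
    · have hne : Y⁻¹ *ᵥ x ≠ 0 := fun h0 => by
        have := hY.inv.dotProduct_mulVec_pos hx
        rw [h0, dotProduct_zero] at this
        exact lt_irrefl _ this
      rw [star_trivial, ← mulVec_mulVec]
      nth_rw 1 [← hYs]
      rw [dotProduct_transpose_mulVec]
      simpa using dotProduct_star_self_pos_iff.2 hne
  obtain ⟨c, hc, hcb⟩ := exists_pos_le_matrixForm_pairVec hYY
  -- The `c` compares `|Y⁻¹ (η - η')|²` with `‖η - η'‖ ^ 2`, and the `2` is the one in front of the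
  -- pairing in the dissipation inequality.
  refine ⟨ε * c / 2, by positivity, fun w η η' hu hu' hz hz' => ?_⟩
  set u := gain (Z * Y⁻¹) η with hudef
  set u' := gain (Z * Y⁻¹) η' with hudef'
  set z := S.dcOutput w u with hzdef
  set z' := S.dcOutput w u' with hzdef'
  -- In this variable `K (η - η') = Z ζ`, and pairing with `ζ` is pairing with `η - η'` in the
  -- metric `Y⁻¹`.
  set ζ := Y⁻¹ *ᵥ pairVec q nc (η - η') with hζ
  have hdu : (u - u').ofLp = Z *ᵥ ζ := by
    rw [hudef, hudef', ← map_sub, ofLp_gain, hζ, mulVec_mulVec]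
  have hdz : (z - z').ofLp = S.Gu *ᵥ (Z *ᵥ ζ) := by
    rw [hzdef, hzdef', dcOutput_sub, ofLp_mlin, hdu]
  set p₁ := (gradient ft u - gradient ft u').ofLp with hp₁
  set p₂ := (gradient gt z - gradient gt z').ofLp with hp₂
  have hgf : (gradient S.f₀ u - gradient S.f₀ u').ofLp = Q₁ *ᵥ (Z *ᵥ ζ) + p₁ := by
    rw [(hf.2.2 u hu).2, (hf.2.2 u' hu').2, ← hdu, hp₁]
    simp only [WithLp.ofLp_add, WithLp.ofLp_sub, toEuclideanLin_eq_mlin, ofLp_mlin, mulVec_sub]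
    abel
  have hgg : (gradient S.g₀ z - gradient S.g₀ z').ofLp = Q₂ *ᵥ (S.Gu *ᵥ (Z *ᵥ ζ)) + p₂ := by
    rw [(hg.2.2 z hz).2, (hg.2.2 z' hz').2, ← hdz, hp₂]
    simp only [WithLp.ofLp_add, WithLp.ofLp_sub, toEuclideanLin_eq_mlin, ofLp_mlin, mulVec_sub]
    abel
  have hfield : pairVec q nc (S.slowField Tz Tu w u z - S.slowField Tz Tu w u' z') =
      (S.lfrB Tz Tu Q₁ Q₂ * Z) *ᵥ ζ + lfrB₁ nc Tz Tu *ᵥ Sum.elim p₁ p₂ := by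
    rw [← mulVec_mulVec, lfrB, lfrB₁, fromRows_mulVec, fromRows_mulVec, fromCols_mulVec,
      pairVec_apply]
    have e1 : (S.slowField Tz Tu w u z - S.slowField Tz Tu w u' z').1 =
        -(mlin Tuᵀ (gradient S.f₀ u - gradient S.f₀ u') +
          mlin Tzᵀ (gradient S.g₀ z - gradient S.g₀ z')) := by
      simp only [slowField, Prod.mk_sub_mk, map_sub]
      abel
    have e2 : (S.slowField Tz Tu w u z - S.slowField Tz Tu w u' z').2 =
        -(mlin S.Hz (z - z') + mlin S.Hu (u - u')) := by
      simp only [slowField, Prod.mk_sub_mk, violation, map_sub, toEuclideanLin_eq_mlin]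
      abel
    rw [e1, e2]
    simp only [WithLp.ofLp_neg, WithLp.ofLp_add, ofLp_mlin, hgf, hgg, hdu, hdz, Qred, N]
    ext i
    rcases i with i | i
    · simp only [Sum.elim_inl, Pi.add_apply, Pi.neg_apply, mulVec_add, add_mulVec, neg_mulVec,
        ← mulVec_mulVec, Sum.elim_comp_inl, Sum.elim_comp_inr]
      ring
    · simp only [Sum.elim_inr, Pi.add_apply, Pi.neg_apply, add_mulVec, neg_mulVec,
        ← mulVec_mulVec, zero_mulVec, Pi.zero_apply]
      ring
  have hE : (S.lfrE₁ * Z) *ᵥ ζ = Sum.elim (u - u').ofLp (z - z').ofLp := by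
    rw [← mulVec_mulVec, lfrE₁, fromRows_mulVec, one_mulVec, hdu, hdz]
  have hd' := hd ζ (Sum.elim p₁ p₂)
  rw [← hfield, hE, dotProduct_daug_mulVec, smul_mulVec, smul_mulVec, dotProduct_smul,
    dotProduct_smul, smul_eq_mul, smul_eq_mul] at hd'
  have s1 := mul_nonneg (inv_nonneg.2 hθ₁.le) (hΘ₁.sector u hu u' hu')
  have s2 := mul_nonneg (inv_nonneg.2 hθ₂.le) (hΘ₂.sector z hz z' hz')
  have e3 : matrixForm (pairVec q nc) Y⁻¹ (η - η')
      (S.slowField Tz Tu w u z - S.slowField Tz Tu w u' z') =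
      ζ ⬝ᵥ pairVec q nc (S.slowField Tz Tu w u z - S.slowField Tz Tu w u' z') := by
    rw [matrixForm_apply, hζ]
    nth_rw 1 [← hYs]
    rw [dotProduct_transpose_mulVec, dotProduct_comm]
  have e4 := hcb (η - η')
  have e5 : matrixForm (pairVec q nc) (Y⁻¹ * Y⁻¹) (η - η') (η - η') = ζ ⬝ᵥ ζ := by
    rw [matrixForm_apply, hζ, ← mulVec_mulVec]
    nth_rw 1 [← hYs]
    rw [dotProduct_transpose_mulVec]
  rw [e5] at e4
  rw [e3]
  have e6 := mul_le_mul_of_nonneg_left e4 hε.le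
  linarith

/-- The constraint matrix has `r + nc` rows and `r + m` columns, so by rank–nullity its kernel has
dimension at least `m - nc`; being the range of a matrix with `q` columns, it has dimension at most
`q`. -/
theorem le_add_of_spansConstraintKernel (hT : S.SpansConstraintKernel Tz Tu) : m ≤ q + nc := by
  have h1 := LinearMap.finrank_range_add_finrank_ker
    (fromBlocks 1 (-S.Gu) S.Hz S.Hu).mulVecLin
  have h2 := LinearMap.finrank_range_le (fromRows Tz Tu).mulVecLin
  have h3 := Submodule.finrank_le (LinearMap.range (fromBlocks 1 (-S.Gu) S.Hz S.Hu).mulVecLin)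
  rw [SpansConstraintKernel] at hT
  rw [← hT] at h1
  simp only [Module.finrank_fintype_fun_eq_card, Fintype.card_sum, Fintype.card_fin] at h1 h2 h3
  omega

/-- A controller direction invisible to the input would not move the reduced field at all,
contradicting strict dissipation; this gives injectivity. The dimension count supplies the reverse
inequality. Surjectivity is what guarantees that the optimal input is attainable. -/
theorem SynthesisLMI.gain_bijective (h : S.SynthesisLMI Tz Tu Q₁ Q₂ Θ₁ Θ₂ ρ γ Y Z θ₁ θ₂)
    (hs₁ : Θ₁.IsSymm) (hs₂ : Θ₂.IsSymm) (hu₁ : IsUnit Θ₁.det) (hu₂ : IsUnit Θ₂.det)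
    (h₁ : (-Θ₁.toBlocks₁₁).PosSemidef) (h₂ : (-Θ₂.toBlocks₁₁).PosSemidef)
    (hT : S.SpansConstraintKernel Tz Tu) : Function.Bijective (gain (Z * Y⁻¹)) := by
  obtain ⟨ε, hε, hd⟩ := SynthesisLMI.dissipation S h hs₁ hs₂ hu₁ hu₂ h₁ h₂
  have hY := h.1
  have hinj : Function.Injective (gain (Z * Y⁻¹)).toLinearMap := by
    rw [← LinearMap.ker_eq_bot, LinearMap.ker_eq_bot']
    intro η hη
    set ζ := Y⁻¹ *ᵥ pairVec q nc η with hζ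
    have hZ : Z *ᵥ ζ = 0 := by
      have := ofLp_gain (Z * Y⁻¹) η
      rw [hζ, mulVec_mulVec, ← this]
      exact congrArg WithLp.ofLp hη
    have h0 := hd ζ 0
    have e1 : Sum.elim (0 : Fin m ⊕ Fin r → ℝ) (0 : Fin m ⊕ Fin r → ℝ) = 0 := by
      ext i; rcases i with i | i <;> rfl
    rw [← mulVec_mulVec, ← mulVec_mulVec, hZ, mulVec_zero, mulVec_zero, mulVec_zero, add_zero,
      dotProduct_zero, e1, zero_dotProduct] at h0
    have hζ0 : ζ = 0 := by
      have h5 : 0 ≤ ζ ⬝ᵥ ζ := by simpa using dotProduct_star_self_nonneg ζ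
      have h6 : ζ ⬝ᵥ ζ = 0 := by nlinarith
      exact dotProduct_self_eq_zero.1 h6
    obtain ⟨c, hc, hcb⟩ := exists_pos_le_matrixForm_pairVec hY.inv
    have h7 := hcb η
    rw [matrixForm_apply, ← hζ, hζ0, dotProduct_zero] at h7
    have h8 : ‖η‖ ^ 2 = 0 := by nlinarith [sq_nonneg ‖η‖]
    exact norm_eq_zero.1 (pow_eq_zero_iff two_ne_zero |>.1 h8)
  have hle := LinearMap.finrank_le_finrank_of_injective hinj
  have hge := le_add_of_spansConstraintKernel hT
  have heq : Module.finrank ℝ (EuclideanSpace ℝ (Fin q) × EuclideanSpace ℝ (Fin nc)) =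
      Module.finrank ℝ (EuclideanSpace ℝ (Fin m)) := by
    simp only [Module.finrank_prod, finrank_euclideanSpace, Fintype.card_fin] at hle ⊢
    omega
  exact ⟨hinj, (LinearMap.injective_iff_surjective_of_finrank_eq_finrank heq).1 hinj⟩

end Data

/-! ### Optimality conditions and uniformity in the exogenous signal. -/

theorem exists_uniform_lipschitz {V W : Type*} [PseudoMetricSpace V] [PseudoMetricSpace W]
    {f : V → W} {s C : Set V} (hf : LocallyLipschitzOn s f) (hs : IsOpen s) (hC : IsCompact C)
    (hCs : C ⊆ s) : ∃ ℓ : NNReal, ∀ x ∈ C, ∃ t ∈ nhds x, LipschitzOnWith ℓ f t := by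
  refine hC.induction_on (p := fun C => ∃ ℓ : NNReal, ∀ x ∈ C, ∃ t ∈ nhds x, LipschitzOnWith ℓ f t)
    ⟨0, fun x hx => hx.elim⟩ (fun A B hAB ⟨ℓ, h⟩ => ⟨ℓ, fun x hx => h x (hAB hx)⟩) ?_ ?_
  · rintro A B ⟨ℓ, h⟩ ⟨ℓ', h'⟩
    refine ⟨max ℓ ℓ', fun x hx => ?_⟩
    rcases hx with hx | hx
    · obtain ⟨t, ht, hL⟩ := h x hx
      exact ⟨t, ht, hL.weaken (le_max_left _ _)⟩
    · obtain ⟨t, ht, hL⟩ := h' x hx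
      exact ⟨t, ht, hL.weaken (le_max_right _ _)⟩
  · intro x hx
    obtain ⟨ℓ, t, ht, hL⟩ := hf (hCs hx)
    rw [hs.nhdsWithin_eq (hCs hx)] at ht
    refine ⟨interior t, mem_nhdsWithin_of_mem_nhds (interior_mem_nhds.2 ht), ℓ, fun y hy => ?_⟩
    exact ⟨t, mem_interior_iff_mem_nhds.1 hy, hL⟩

namespace Data

variable {n m r nc nw q : ℕ} {S : Data n m r nc nw} {Tz : Matrix (Fin r) (Fin q) ℝ}
  {Tu : Matrix (Fin m) (Fin q) ℝ}

theorem SpansConstraintKernel.apply (hT : S.SpansConstraintKernel Tz Tu)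
    (c : EuclideanSpace ℝ (Fin q)) :
    mlin Tz c = mlin S.Gu (mlin Tu c) ∧ mlin S.Hz (mlin Tz c) + mlin S.Hu (mlin Tu c) = 0 := by
  have h1 : (fromRows Tz Tu).mulVecLin c.ofLp ∈
      LinearMap.ker (fromBlocks 1 (-S.Gu) S.Hz S.Hu).mulVecLin := by
    rw [← hT]; exact ⟨_, rfl⟩
  rw [LinearMap.mem_ker, mulVecLin_apply, mulVecLin_apply, fromRows_mulVec, fromBlocks_mulVec,
    Sum.elim_comp_inl, Sum.elim_comp_inr, one_mulVec, neg_mulVec] at h1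
  constructor
  · apply WithLp.ofLp_injective
    have := congrArg (fun f => f ∘ Sum.inl) h1
    rw [Sum.elim_comp_inl] at this
    rw [ofLp_mlin, ofLp_mlin, ofLp_mlin]
    exact sub_eq_zero.1 (by rw [sub_eq_add_neg]; exact this)
  · apply WithLp.ofLp_injective
    have := congrArg (fun f => f ∘ Sum.inr) h1
    rw [Sum.elim_comp_inr] at this
    exact this

/-- First-order optimality conditions at an interior optimal point. -/
theorem IsOptimal.slowField_eq_zero (hT : S.SpansConstraintKernel Tz Tu)
    {w : EuclideanSpace ℝ (Fin nw)} {u : EuclideanSpace ℝ (Fin m)} {z : EuclideanSpace ℝ (Fin r)}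
    (h : S.IsOptimal w u z) (hu : u ∈ interior S.Uset) (hz : z ∈ interior S.Zset)
    (hf : DifferentiableAt ℝ S.f₀ u) (hg : DifferentiableAt ℝ S.g₀ z) :
    S.slowField Tz Tu w u z = 0 := by
  obtain ⟨⟨-, -, hzu, hviol⟩, hmin⟩ := h
  -- Moving along `(Tu c, Tz c)` preserves the equality constraints, and for this `c` the derivative
  -- of the cost is `|c|²`; its vanishing is the claim.
  obtain ⟨c, hc⟩ : ∃ c, c = mlin Tuᵀ (gradient S.f₀ u) + mlin Tzᵀ (gradient S.g₀ z) := ⟨_, rfl⟩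
  obtain ⟨hk1, hk2⟩ := hT.apply c
  have hcu : Continuous fun t : ℝ => u + t • mlin Tu c := by fun_prop
  have hcz : Continuous fun t : ℝ => z + t • mlin Tz c := by fun_prop
  have hloc : IsLocalMin (fun t : ℝ => S.f₀ (u + t • mlin Tu c) + S.g₀ (z + t • mlin Tz c)) 0 := by
    have e1 : ∀ᶠ t in nhds (0 : ℝ), u + t • mlin Tu c ∈ interior S.Uset :=
      hcu.continuousAt.eventually_mem (isOpen_interior.mem_nhds (by simpa using hu))
    have e2 : ∀ᶠ t in nhds (0 : ℝ), z + t • mlin Tz c ∈ interior S.Zset :=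
      hcz.continuousAt.eventually_mem (isOpen_interior.mem_nhds (by simpa using hz))
    filter_upwards [e1, e2] with t h1 h2
    simp only [zero_smul, add_zero]
    refine hmin _ _ ⟨interior_subset h1, interior_subset h2, ?_, ?_⟩
    · simp only [toEuclideanLin_eq_mlin] at hzu ⊢
      rw [map_add, map_smul, ← hk1]
      nth_rw 1 [hzu]
      abel
    · simp only [violation, toEuclideanLin_eq_mlin] at hviol ⊢
      rw [map_add, map_add, map_smul, map_smul]
      have : mlin S.Hz z + t • mlin S.Hz (mlin Tz c) + (mlin S.Hu u + t • mlin S.Hu (mlin Tu c)) +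
          mlin S.Hw w = (mlin S.Hz z + mlin S.Hu u + mlin S.Hw w) +
            t • (mlin S.Hz (mlin Tz c) + mlin S.Hu (mlin Tu c)) := by
        rw [smul_add]; abel
      rw [this, hviol, hk2, smul_zero, add_zero]
  have hd1 : HasDerivAt (fun t : ℝ => S.f₀ (u + t • mlin Tu c))
      (inner ℝ (gradient S.f₀ u) (mlin Tu c)) 0 := by
    have hl : HasDerivAt (fun t : ℝ => u + t • mlin Tu c) (mlin Tu c) 0 := by
      simpa using ((hasDerivAt_id (0 : ℝ)).smul_const (mlin Tu c)).const_add u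
    have hF := hf.hasGradientAt.hasFDerivAt
    have hF' : HasFDerivAt S.f₀ (InnerProductSpace.toDual ℝ _ (gradient S.f₀ u))
        (u + (0 : ℝ) • mlin Tu c) := by simpa using hF
    exact hF'.comp_hasDerivAt (0 : ℝ) hl
  have hd2 : HasDerivAt (fun t : ℝ => S.g₀ (z + t • mlin Tz c))
      (inner ℝ (gradient S.g₀ z) (mlin Tz c)) 0 := by
    have hl : HasDerivAt (fun t : ℝ => z + t • mlin Tz c) (mlin Tz c) 0 := by
      simpa using ((hasDerivAt_id (0 : ℝ)).smul_const (mlin Tz c)).const_add z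
    have hF := hg.hasGradientAt.hasFDerivAt
    have hF' : HasFDerivAt S.g₀ (InnerProductSpace.toDual ℝ _ (gradient S.g₀ z))
        (z + (0 : ℝ) • mlin Tz c) := by simpa using hF
    exact hF'.comp_hasDerivAt (0 : ℝ) hl
  have h0 := hloc.hasDerivAt_eq_zero (hd1.add hd2)
  rw [inner_mlin, inner_mlin, ← inner_add_left, ← hc, inner_self_eq_zero] at h0
  rw [slowField, ← hc, h0, hviol, neg_zero, neg_zero]
  rfl

theorem slowField_sub_le {w : EuclideanSpace ℝ (Fin nw)} {ℓ : NNReal}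
    {tu : Set (EuclideanSpace ℝ (Fin m))} {tz : Set (EuclideanSpace ℝ (Fin r))}
    (hu : LipschitzOnWith ℓ (gradient S.f₀) tu) (hz : LipschitzOnWith ℓ (gradient S.g₀) tz)
    {u u' : EuclideanSpace ℝ (Fin m)} {z z' : EuclideanSpace ℝ (Fin r)} (h1 : u ∈ tu)
    (h1' : u' ∈ tu) (h2 : z ∈ tz) (h2' : z' ∈ tz) :
    ‖S.slowField Tz Tu w u z - S.slowField Tz Tu w u' z'‖ ≤
      ((‖mlin Tuᵀ‖ + ‖mlin Tzᵀ‖) * ℓ + ‖mlin S.Hz‖ + ‖mlin S.Hu‖) * (‖u - u'‖ + ‖z - z'‖) := by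
  have e1 : (S.slowField Tz Tu w u z - S.slowField Tz Tu w u' z').1 =
      -(mlin Tuᵀ (gradient S.f₀ u - gradient S.f₀ u') +
        mlin Tzᵀ (gradient S.g₀ z - gradient S.g₀ z')) := by
    simp only [slowField, Prod.mk_sub_mk, map_sub]
    abel
  have e2 : (S.slowField Tz Tu w u z - S.slowField Tz Tu w u' z').2 =
      -(mlin S.Hz (z - z') + mlin S.Hu (u - u')) := by
    simp only [slowField, Prod.mk_sub_mk, violation, map_sub, toEuclideanLin_eq_mlin]
    abel
  have l1 := hu.dist_le_mul u h1 u' h1'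
  have l2 := hz.dist_le_mul z h2 z' h2'
  rw [dist_eq_norm, dist_eq_norm] at l1 l2
  have n1 : ‖(S.slowField Tz Tu w u z - S.slowField Tz Tu w u' z').1‖ ≤
      ‖mlin Tuᵀ‖ * (ℓ * ‖u - u'‖) + ‖mlin Tzᵀ‖ * (ℓ * ‖z - z'‖) := by
    rw [e1, norm_neg]
    refine (norm_add_le _ _).trans (add_le_add ?_ ?_)
    · exact ((mlin Tuᵀ).le_opNorm _).trans (mul_le_mul_of_nonneg_left l1 (norm_nonneg _))
    · exact ((mlin Tzᵀ).le_opNorm _).trans (mul_le_mul_of_nonneg_left l2 (norm_nonneg _))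
  have n2 : ‖(S.slowField Tz Tu w u z - S.slowField Tz Tu w u' z').2‖ ≤
      ‖mlin S.Hz‖ * ‖z - z'‖ + ‖mlin S.Hu‖ * ‖u - u'‖ := by
    rw [e2, norm_neg]
    exact (norm_add_le _ _).trans (add_le_add ((mlin S.Hz).le_opNorm _) ((mlin S.Hu).le_opNorm _))
  set a := ‖u - u'‖
  set b := ‖z - z'‖
  have ha : 0 ≤ a := norm_nonneg _
  have hb : 0 ≤ b := norm_nonneg _
  have p1 : 0 ≤ ‖mlin Tuᵀ‖ * ℓ := by positivity
  have p2 : 0 ≤ ‖mlin Tzᵀ‖ * ℓ := by positivity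
  have p3 : 0 ≤ ‖mlin S.Hz‖ := norm_nonneg _
  have p4 : 0 ≤ ‖mlin S.Hu‖ := norm_nonneg _
  rw [Prod.norm_def]
  refine max_le (n1.trans ?_) (n2.trans ?_)
  · nlinarith [mul_nonneg p1 hb, mul_nonneg p2 ha, mul_nonneg p3 ha, mul_nonneg p3 hb,
      mul_nonneg p4 ha, mul_nonneg p4 hb]
  · nlinarith [mul_nonneg p1 hb, mul_nonneg p2 ha, mul_nonneg p3 ha, mul_nonneg p4 hb,
      mul_nonneg p1 ha, mul_nonneg p2 hb]

/-- Strong dissipativity of the reduced slow dynamics, with the metric `BH`. -/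
def SlowDissipative (S : Data n m r nc nw) (Tz : Matrix (Fin r) (Fin q) ℝ)
    (Tu : Matrix (Fin m) (Fin q) ℝ) (K : Matrix (Fin m) (Fin q ⊕ Fin nc) ℝ)
    (BH : (EuclideanSpace ℝ (Fin q) × EuclideanSpace ℝ (Fin nc)) →L[ℝ]
      (EuclideanSpace ℝ (Fin q) × EuclideanSpace ℝ (Fin nc)) →L[ℝ] ℝ) (ε : ℝ) : Prop :=
  ∀ (w : EuclideanSpace ℝ (Fin nw))
    (η η' : EuclideanSpace ℝ (Fin q) × EuclideanSpace ℝ (Fin nc)),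
    gain K η ∈ interior S.Uset → gain K η' ∈ interior S.Uset →
    S.dcOutput w (gain K η) ∈ interior S.Zset → S.dcOutput w (gain K η') ∈ interior S.Zset →
    BH (η - η') (S.slowField Tz Tu w (gain K η) (S.dcOutput w (gain K η)) -
      S.slowField Tz Tu w (gain K η') (S.dcOutput w (gain K η'))) ≤ -ε * ‖η - η'‖ ^ 2

variable {K : Matrix (Fin m) (Fin q ⊕ Fin nc) ℝ}
  {BH : (EuclideanSpace ℝ (Fin q) × EuclideanSpace ℝ (Fin nc)) →L[ℝ]
    (EuclideanSpace ℝ (Fin q) × EuclideanSpace ℝ (Fin nc)) →L[ℝ] ℝ} {ε : ℝ}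

/-- An error bound for a strongly monotone equation: distance to a zero is controlled by the
residual. It yields both uniqueness of the equilibrium and its continuity in `w`. -/
theorem SlowDissipative.norm_sub_le (hd : S.SlowDissipative Tz Tu K BH ε) (hε : 0 < ε)
    {w : EuclideanSpace ℝ (Fin nw)}
    {η η' : EuclideanSpace ℝ (Fin q) × EuclideanSpace ℝ (Fin nc)}
    (h1 : gain K η ∈ interior S.Uset) (h2 : gain K η' ∈ interior S.Uset)
    (h3 : S.dcOutput w (gain K η) ∈ interior S.Zset)
    (h4 : S.dcOutput w (gain K η') ∈ interior S.Zset)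
    (h0 : S.slowField Tz Tu w (gain K η) (S.dcOutput w (gain K η)) = 0) :
    ‖η - η'‖ ≤ ‖BH‖ / ε * ‖S.slowField Tz Tu w (gain K η') (S.dcOutput w (gain K η'))‖ := by
  have h := hd w η η' h1 h2 h3 h4
  rw [h0, zero_sub, map_neg] at h
  set v := S.slowField Tz Tu w (gain K η') (S.dcOutput w (gain K η'))
  have hb := (le_abs_self _).trans (BH.le_opNorm₂ (η - η') v)
  rw [div_mul_eq_mul_div, le_div_iff₀ hε]
  rcases eq_or_lt_of_le (norm_nonneg (η - η')) with h5 | h5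
  · rw [← h5, zero_mul]; positivity
  · have : ‖η - η'‖ * (‖η - η'‖ * ε) ≤ ‖η - η'‖ * (‖BH‖ * ‖v‖) := by nlinarith
    exact le_of_mul_le_mul_left this h5

/-- The zero of the reduced slow dynamics depends continuously on the exogenous signal. -/
theorem SlowDissipative.continuousOn (hd : S.SlowDissipative Tz Tu K BH ε) (hε : 0 < ε)
    (hg : ContinuousOn (gradient S.g₀) (interior S.Zset))
    {W : Set (EuclideanSpace ℝ (Fin nw))}
    {η : EuclideanSpace ℝ (Fin nw) → EuclideanSpace ℝ (Fin q) × EuclideanSpace ℝ (Fin nc)}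
    (hu : ∀ w ∈ W, gain K (η w) ∈ interior S.Uset)
    (hz : ∀ w ∈ W, S.dcOutput w (gain K (η w)) ∈ interior S.Zset)
    (h0 : ∀ w ∈ W, S.slowField Tz Tu w (gain K (η w)) (S.dcOutput w (gain K (η w))) = 0) :
    ContinuousOn η W := by
  intro w₀ hw₀
  -- Freeze the controller state at `η w₀` and vary only the signal: the residual at `w` then tends
  -- to its value `0` at `w₀` and bounds the distance to `η w`.
  set u₀ := gain K (η w₀) with hu₀
  have hcz : Continuous fun w => S.dcOutput w u₀ := by
    unfold dcOutput; fun_prop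
  have hgc : ContinuousAt (fun w => gradient S.g₀ (S.dcOutput w u₀)) w₀ :=
    ContinuousAt.comp (f := fun w => S.dcOutput w u₀)
      (hg.continuousAt (isOpen_interior.mem_nhds (hz w₀ hw₀))) hcz.continuousAt
  have hs : ContinuousAt (fun w => S.slowField Tz Tu w u₀ (S.dcOutput w u₀)) w₀ := by
    unfold slowField violation
    simp only [toEuclideanLin_eq_mlin]
    refine ContinuousAt.prodMk ?_ ?_
    · exact (continuousAt_const.add ((mlin Tzᵀ).continuous.continuousAt.comp hgc)).neg
    · have : Continuous fun w => -(mlin S.Hz (S.dcOutput w u₀) + mlin S.Hu u₀ + mlin S.Hw w) := by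
        fun_prop
      exact this.continuousAt
  rw [ContinuousWithinAt, tendsto_iff_norm_sub_tendsto_zero]
  have hlim : Filter.Tendsto
      (fun w => ‖BH‖ / ε * ‖S.slowField Tz Tu w u₀ (S.dcOutput w u₀)‖) (nhdsWithin w₀ W)
      (nhds 0) := by
    have h1 := (hs.norm.const_mul (‖BH‖ / ε)).tendsto.mono_left
      (nhdsWithin_le_nhds (s := W))
    rw [h0 w₀ hw₀, norm_zero, mul_zero] at h1
    exact h1
  refine squeeze_zero' (Filter.Eventually.of_forall fun _ => norm_nonneg _) ?_ hlim
  have hev : ∀ᶠ w in nhdsWithin w₀ W, S.dcOutput w u₀ ∈ interior S.Zset :=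
    (hcz.continuousAt.eventually_mem (isOpen_interior.mem_nhds (hz w₀ hw₀))).filter_mono
      nhdsWithin_le_nhds
  filter_upwards [hev, self_mem_nhdsWithin] with w hw hwW
  exact hd.norm_sub_le hε (hu w hwW) (hu w₀ hw₀) (hz w hwW) hw (h0 w hwW)

end Data

/-! ### Local exponential stability of the closed loop. -/

namespace Data

variable {n m r nc nw q : ℕ} {S : Data n m r nc nw} {Tz : Matrix (Fin r) (Fin q) ℝ}
  {Tu : Matrix (Fin m) (Fin q) ℝ} {K : Matrix (Fin m) (Fin q ⊕ Fin nc) ℝ}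
  {BH : (EuclideanSpace ℝ (Fin q) × EuclideanSpace ℝ (Fin nc)) →L[ℝ]
    (EuclideanSpace ℝ (Fin q) × EuclideanSpace ℝ (Fin nc)) →L[ℝ] ℝ} {ε : ℝ}

variable (S K) in
/-- Linear part of the quasi-steady state of the plant as a function of the controller state. -/
def dcGain : EuclideanSpace ℝ (Fin q) × EuclideanSpace ℝ (Fin nc) →L[ℝ] EuclideanSpace ℝ (Fin n) :=
  -((mlin S.A⁻¹).comp ((mlin S.B).comp (gain K)))

variable (S K) in
/-- Deviation of the plant state from its quasi-steady state. -/
def fastPart : State n q nc →L[ℝ] EuclideanSpace ℝ (Fin n) :=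
  ContinuousLinearMap.fst ℝ _ _ - (S.dcGain K).comp (ContinuousLinearMap.snd ℝ _ _)

variable (S K) in
/-- Linear part of the output map. -/
def outputPart : State n q nc →L[ℝ] EuclideanSpace ℝ (Fin r) :=
  (mlin S.C).comp (S.fastPart K) +
    (mlin S.Gu).comp ((gain K).comp (ContinuousLinearMap.snd ℝ _ _))

theorem fastPart_sub (w : EuclideanSpace ℝ (Fin nw)) (ξ ξ' : State n q nc) :
    (ξ.1 - S.dcState w (gain K ξ.2)) - (ξ'.1 - S.dcState w (gain K ξ'.2)) =
      S.fastPart K (ξ - ξ') := by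
  have h : S.fastPart K (ξ - ξ') = (ξ.1 - ξ'.1) - -(mlin S.A⁻¹ (mlin S.B (gain K (ξ.2 - ξ'.2)))) :=
    rfl
  rw [h, map_sub, ← dcState_sub S w]
  abel

theorem output_sub (w : EuclideanSpace ℝ (Fin nw)) (ξ ξ' : State n q nc) :
    S.output K w ξ - S.output K w ξ' = S.outputPart K (ξ - ξ') := by
  have h : S.outputPart K (ξ - ξ') =
    mlin S.C (S.fastPart K (ξ - ξ')) + mlin S.Gu (gain K (ξ.2 - ξ'.2)) := rfl
  rw [h, ← fastPart_sub w, map_sub (gain K), ← dcOutput_sub S w, output_eq, output_eq]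
  simp only [map_sub]
  abel

theorem exists_lipschitzOnWith_closedLoop (hA : IsUnit S.A.det) (τ : ℝ)
    {w : EuclideanSpace ℝ (Fin nw)} {ℓ : NNReal} {tu : Set (EuclideanSpace ℝ (Fin m))}
    {tz : Set (EuclideanSpace ℝ (Fin r))}
    (hu : LipschitzOnWith ℓ (gradient S.f₀) tu) (hz : LipschitzOnWith ℓ (gradient S.g₀) tz)
    {s : Set (State n q nc)} (hsu : ∀ ξ ∈ s, gain K ξ.2 ∈ tu) (hsz : ∀ ξ ∈ s, S.output K w ξ ∈ tz) :
    ∃ C : NNReal, LipschitzOnWith C (S.closedLoop Tz Tu K τ τ w) s := by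
  set c := (‖mlin Tuᵀ‖ + ‖mlin Tzᵀ‖) * ℓ + ‖mlin S.Hz‖ + ‖mlin S.Hu‖ with hc
  have hc0 : 0 ≤ c := by positivity
  set g : State n q nc →L[ℝ] _ := (gain K).comp (ContinuousLinearMap.snd ℝ _ _) with hg
  set C₁ := ‖mlin S.A‖ * ‖S.fastPart K‖
  set C₂ := ‖τ⁻¹‖ * (c * (‖g‖ + ‖S.outputPart K‖))
  refine ⟨(C₁ + C₂).toNNReal, LipschitzOnWith.of_dist_le_mul fun ξ hξ ξ' hξ' => ?_⟩
  have hC₁ : 0 ≤ C₁ := by positivity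
  have hC₂ : 0 ≤ C₂ := by positivity
  rw [Real.coe_toNNReal _ (add_nonneg hC₁ hC₂), dist_eq_norm, dist_eq_norm, Prod.norm_def]
  have hn := norm_nonneg (ξ - ξ')
  refine max_le ?_ ?_
  · have h1 : (S.closedLoop Tz Tu K τ τ w ξ - S.closedLoop Tz Tu K τ τ w ξ').1 =
        mlin S.A (S.fastPart K (ξ - ξ')) := by
      rw [Prod.fst_sub, closedLoop_fst S hA, closedLoop_fst S hA, ← map_sub, fastPart_sub]
    rw [h1]
    have h2 := (mlin S.A).le_opNorm (S.fastPart K (ξ - ξ'))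
    have h3 := mul_le_mul_of_nonneg_left ((S.fastPart K).le_opNorm (ξ - ξ'))
      (norm_nonneg (mlin S.A))
    have h4 : ‖mlin S.A‖ * (‖S.fastPart K‖ * ‖ξ - ξ'‖) = C₁ * ‖ξ - ξ'‖ := by ring
    nlinarith [mul_nonneg hC₂ hn]
  · have h1 : (S.closedLoop Tz Tu K τ τ w ξ - S.closedLoop Tz Tu K τ τ w ξ').2 =
        τ⁻¹ • (S.slowField Tz Tu w (gain K ξ.2) (S.output K w ξ) -
          S.slowField Tz Tu w (gain K ξ'.2) (S.output K w ξ')) := by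
      rw [Prod.snd_sub, closedLoop_snd, closedLoop_snd, smul_sub]
    rw [h1, norm_smul]
    have h2 := slowField_sub_le (Tz := Tz) (Tu := Tu) (w := w) hu hz (hsu ξ hξ) (hsu ξ' hξ')
      (hsz ξ hξ) (hsz ξ' hξ')
    rw [output_sub, ← map_sub] at h2
    have h3 : ‖gain K (ξ.2 - ξ'.2)‖ ≤ ‖g‖ * ‖ξ - ξ'‖ := g.le_opNorm (ξ - ξ')
    have h4 := (S.outputPart K).le_opNorm (ξ - ξ')
    have h5 := h2.trans (mul_le_mul_of_nonneg_left (add_le_add h3 h4) hc0)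
    have h6 := mul_le_mul_of_nonneg_left h5 (norm_nonneg τ⁻¹)
    have h7 : ‖τ⁻¹‖ * (c * (‖g‖ * ‖ξ - ξ'‖ + ‖S.outputPart K‖ * ‖ξ - ξ'‖)) = C₂ * ‖ξ - ξ'‖ := by
      ring
    nlinarith [mul_nonneg hC₁ hn]

theorem continuous_output (w : EuclideanSpace ℝ (Fin nw)) : Continuous (S.output K w) := by
  have : S.output K w = fun ξ => S.output K w 0 + S.outputPart K ξ := by
    ext1 ξ
    have := output_sub (S := S) (K := K) w ξ 0
    rw [sub_zero] at this
    rw [← this]; abel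
  rw [this]
  fun_prop

/-- For slow enough controllers, every zero of the reduced dynamics with a given local Lipschitz
bound on the gradients is a locally exponentially stable equilibrium. -/
theorem SlowDissipative.exists_stable (hd : S.SlowDissipative Tz Tu K BH ε) (hε : 0 < ε)
    (hA : IsHurwitz S.A) (hs : ∀ x y, BH x y = BH y x) {c : ℝ} (hc : 0 < c)
    (hBH : ∀ y, c * ‖y‖ ^ 2 ≤ BH y y) (ℓ : NNReal) :
    ∃ τ₀ > 0, ∀ τ : ℝ, τ₀ ≤ τ → ∀ (w : EuclideanSpace ℝ (Fin nw)) (p : State n q nc),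
      p.1 = S.dcState w (gain K p.2) → gain K p.2 ∈ interior S.Uset →
      S.dcOutput w (gain K p.2) ∈ interior S.Zset →
      S.slowField Tz Tu w (gain K p.2) (S.dcOutput w (gain K p.2)) = 0 →
      (∃ t ∈ nhds (gain K p.2), LipschitzOnWith ℓ (gradient S.f₀) t) →
      (∃ t ∈ nhds (S.dcOutput w (gain K p.2)), LipschitzOnWith ℓ (gradient S.g₀) t) →
      IsLocallyExpStable (S.closedLoop Tz Tu K τ τ w) (S.domain K w) p := by
  obtain ⟨P, hP, α, hα, hPA⟩ := hA.exists_lyapunov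
  set J : EuclideanSpace ℝ (Fin n) →ₗ[ℝ] Fin n → ℝ :=
    (WithLp.linearEquiv 2 ℝ (Fin n → ℝ)).toLinearMap with hJ
  have hJx : ∀ x, J x = x.ofLp := fun x => rfl
  obtain ⟨cX, hcX, hPX⟩ := exists_pos_mul_dotProduct_le hP
  set c₀ := (‖mlin Tuᵀ‖ + ‖mlin Tzᵀ‖) * ℓ + ‖mlin S.Hz‖ + ‖mlin S.Hu‖ with hc₀
  have hc₀0 : 0 ≤ c₀ := by positivity
  -- `L` bounds the error from using the measured output in place of the steady-state one; `M` is a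
  -- growth bound for the slow field around its zero. Both involve the equilibrium only through `ℓ`,
  -- which is why `τ₀` can precede `w` and `p`.
  obtain ⟨τ₀, hτ₀, hmain⟩ := exists_timescale_stable (mlin S.A) (S.dcGain K) (matrixForm J P) BH
    (matrixForm_symm J hP.transpose_eq) hs (L := ‖BH‖ * (c₀ * ‖mlin S.C‖))
    (M := c₀ * (‖gain K‖ + ‖mlin S.Gu‖ * ‖gain K‖ + ‖mlin S.C‖)) hcX hc hα hε (by positivity)
    (fun x => by rw [matrixForm_apply, hJx, euclidean_norm_sq]; exact hPX _) hBH
    (fun x => by rw [matrixForm_apply, hJx, hJx, euclidean_norm_sq, ofLp_mlin]; exact hPA _)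
  refine ⟨τ₀, hτ₀, fun τ hτ w p hp1 hpu hpz hp0 ⟨tu, htu, hLu⟩ ⟨tz, htz, hLz⟩ => ?_⟩
  have hout : S.output K w p = S.dcOutput w (gain K p.2) := by
    rw [output_eq, hp1, sub_self, map_zero, zero_add]
  have hcg : Continuous fun ξ : State n q nc => gain K ξ.2 := by fun_prop
  have hcd : Continuous fun ξ : State n q nc => S.dcOutput w (gain K ξ.2) := by
    unfold dcOutput; fun_prop
  have ev1 := hcg.continuousAt.eventually_mem
    (Filter.inter_mem htu (isOpen_interior.mem_nhds hpu))
  have ev2 := hcd.continuousAt.eventually_mem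
    (Filter.inter_mem htz (isOpen_interior.mem_nhds hpz))
  have ev3 := (continuous_output (S := S) (K := K) w).continuousAt.eventually_mem
    (x := p) (s := tz ∩ interior S.Zset)
    (by rw [hout]; exact Filter.inter_mem htz (isOpen_interior.mem_nhds hpz))
  obtain ⟨R, hR, hball⟩ := Metric.nhds_basis_closedBall.eventually_iff.1 (ev1.and (ev2.and ev3))
  obtain ⟨KL, hKL⟩ := exists_lipschitzOnWith_closedLoop (Tz := Tz) (Tu := Tu) (K := K) hA.isUnit_det
    τ (w := w) hLu hLz (s := Metric.closedBall p R) (fun ξ hξ => (hball hξ).1.1)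
    (fun ξ hξ => (hball hξ).2.2.1)
  refine hmain τ hτ p _ _ R KL hR (fun ξ hξ => ⟨(hball hξ).1.2, (hball hξ).2.2.2⟩) hKL
    fun ξ hξ => ?_
  obtain ⟨⟨hu1, hu2⟩, ⟨hd1, hd2⟩, hz1, hz2⟩ := hball hξ
  refine ⟨ξ.1 - S.dcState w (gain K ξ.2), ?_, closedLoop_fst S hA.isUnit_det _ _ _ _ _ _,
    S.slowField Tz Tu w (gain K ξ.2) (S.output K w ξ), closedLoop_snd S _ _ _ _ _ _, ?_, ?_⟩
  · have := fastPart_sub (S := S) (K := K) w ξ p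
    rw [hp1, sub_self, sub_zero] at this
    exact this
  all_goals
    set a := ξ.1 - S.dcState w (gain K ξ.2) with ha
    have hza : S.output K w ξ - S.dcOutput w (gain K ξ.2) = mlin S.C a := by
      rw [output_eq, add_sub_cancel_right]
    have hCa := (mlin S.C).le_opNorm a
    have hpt : gain K p.2 ∈ tu := mem_of_mem_nhds htu
    have hpz' : S.dcOutput w (gain K p.2) ∈ tz := mem_of_mem_nhds htz
  · have h1 := hd w ξ.2 p.2 hu2 hpu hd2 hpz
    rw [hp0, sub_zero] at h1
    have h2 := slowField_sub_le (Tz := Tz) (Tu := Tu) (w := w) hLu hLz hu1 hu1 hz1 hd1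
    rw [sub_self, norm_zero, zero_add, hza] at h2
    set v := S.slowField Tz Tu w (gain K ξ.2) (S.output K w ξ)
    set v' := S.slowField Tz Tu w (gain K ξ.2) (S.dcOutput w (gain K ξ.2))
    have h3 := (le_abs_self _).trans (BH.le_opNorm₂ (ξ - p).2 (v - v'))
    have h4 : ‖v - v'‖ ≤ c₀ * (‖mlin S.C‖ * ‖a‖) :=
      h2.trans (mul_le_mul_of_nonneg_left hCa hc₀0)
    have h5 := mul_le_mul_of_nonneg_left h4 (mul_nonneg (norm_nonneg BH) (norm_nonneg (ξ - p).2))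
    have h6 : BH (ξ - p).2 v = BH (ξ - p).2 (v - v') + BH (ξ - p).2 v' := by
      rw [← map_add, sub_add_cancel]
    rw [h6]
    have h7 : ‖BH‖ * ‖(ξ - p).2‖ * (c₀ * (‖mlin S.C‖ * ‖a‖)) =
        ‖BH‖ * (c₀ * ‖mlin S.C‖) * (‖(ξ - p).2‖ * ‖a‖) := by ring
    rw [Prod.snd_sub] at *
    linarith
  · have h2 := slowField_sub_le (Tz := Tz) (Tu := Tu) (w := w) hLu hLz hu1 hpt hz1 hpz'
    rw [hp0, sub_zero] at h2
    have h3 : ‖gain K ξ.2 - gain K p.2‖ ≤ ‖gain K‖ * ‖(ξ - p).2‖ := by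
      rw [← map_sub]; exact (gain K).le_opNorm _
    have h4 : ‖S.output K w ξ - S.dcOutput w (gain K p.2)‖ ≤
        ‖mlin S.C‖ * ‖a‖ + ‖mlin S.Gu‖ * (‖gain K‖ * ‖(ξ - p).2‖) := by
      have e : S.output K w ξ - S.dcOutput w (gain K p.2) =
          mlin S.C a + mlin S.Gu (gain K ξ.2 - gain K p.2) := by
        rw [← hza, ← dcOutput_sub S w]; abel
      rw [e]
      refine (norm_add_le _ _).trans (add_le_add hCa ?_)
      exact ((mlin S.Gu).le_opNorm _).trans (mul_le_mul_of_nonneg_left h3 (norm_nonneg _))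
    refine h2.trans ?_
    rw [mul_assoc c₀]
    refine mul_le_mul_of_nonneg_left ?_ hc₀0
    have i1 : 0 ≤ ‖gain K‖ * ‖a‖ := by positivity
    have i2 : 0 ≤ ‖mlin S.Gu‖ * ‖gain K‖ * ‖a‖ := by positivity
    have i3 : 0 ≤ ‖mlin S.C‖ * ‖(ξ - p).2‖ := by positivity
    nlinarith

end Data
end OSS

end

/-! ### The main theorem. -/

theorem mainTheorem3 {n m r nc nw q : ℕ} (S : OSS.Data n m r nc nw)
    (hS : S.StandingAssumptions)
    (Tz : Matrix (Fin r) (Fin q) ℝ) (Tu : Matrix (Fin m) (Fin q) ℝ)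
    (hT : S.SpansConstraintKernel Tz Tu)
    (ft : EuclideanSpace ℝ (Fin m) → ℝ) (gt : EuclideanSpace ℝ (Fin r) → ℝ)
    (Q₁ : Matrix (Fin m) (Fin m) ℝ) (Q₂ : Matrix (Fin r) (Fin r) ℝ)
    (hf : OSS.IsQuadraticSplit S.Uset S.f₀ ft Q₁)
    (hg : OSS.IsQuadraticSplit S.Zset S.g₀ gt Q₂)
    (Θ₁ : Matrix (Fin m ⊕ Fin m) (Fin m ⊕ Fin m) ℝ)
    (Θ₂ : Matrix (Fin r ⊕ Fin r) (Fin r ⊕ Fin r) ℝ)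
    (hΘ₁ : OSS.IsSectorMultiplier (interior S.Uset) (gradient ft) Θ₁)
    (hΘ₂ : OSS.IsSectorMultiplier (interior S.Zset) (gradient gt) Θ₂)
    (ρ γ : ℝ) (hρ : 0 < ρ) (hγ : 0 < γ)
    (Y : Matrix (Fin q ⊕ Fin nc) (Fin q ⊕ Fin nc) ℝ)
    (Z : Matrix (Fin m) (Fin q ⊕ Fin nc) ℝ) (θ₁ θ₂ : ℝ)
    (hLMI : S.SynthesisLMI Tz Tu Q₁ Q₂ Θ₁ Θ₂ ρ γ Y Z θ₁ θ₂) :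
    ∃ τ₀ > 0, ∀ τ : ℝ, τ₀ ≤ τ → S.SolvesOSS Tz Tu (Z * Y⁻¹) τ τ := by
  obtain ⟨ε, hε, hd⟩ := hLMI.slowField_dissipation hf hg hΘ₁ hΘ₂
  have hbij := hLMI.gain_bijective hΘ₁.symm hΘ₂.symm hΘ₁.nonsing hΘ₂.nonsing hΘ₁.upperLeft
    hΘ₂.upperLeft hT
  obtain ⟨c, hc, hcb⟩ := OSS.exists_pos_le_matrixForm_pairVec hLMI.1.inv
  have hsymm := OSS.matrixForm_symm (OSS.pairVec q nc) hLMI.1.inv.transpose_eq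
  set BH := OSS.matrixForm (OSS.pairVec q nc) Y⁻¹
  set K := Z * Y⁻¹ with hK
  replace hd : S.SlowDissipative Tz Tu K BH ε := hd
  have hdf : ∀ u ∈ interior S.Uset, DifferentiableAt ℝ S.f₀ u := fun u hu =>
    (hS.contDiff_f.differentiableOn one_ne_zero).differentiableAt (isOpen_interior.mem_nhds hu)
  have hdg : ∀ z ∈ interior S.Zset, DifferentiableAt ℝ S.g₀ z := fun z hz =>
    (hS.contDiff_g.differentiableOn one_ne_zero).differentiableAt (isOpen_interior.mem_nhds hz)
  have hex : ∀ w ∈ S.Wset, ∃ η, OSS.Data.gain K η ∈ interior S.Uset ∧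
      S.dcOutput w (OSS.Data.gain K η) ∈ interior S.Zset ∧
      S.IsOptimal w (OSS.Data.gain K η) (S.dcOutput w (OSS.Data.gain K η)) := by
    intro w hw
    obtain ⟨u, hu, z, hz, hopt⟩ := hS.exists_optimal w hw
    obtain ⟨η, rfl⟩ := hbij.2 u
    have hzz : z = S.dcOutput w (OSS.Data.gain K η) := hopt.1.2.2.1
    subst hzz
    exact ⟨η, hu, hz, hopt⟩
  choose! η hηu hηz hopt using hex
  have h0 : ∀ w ∈ S.Wset, S.slowField Tz Tu w (OSS.Data.gain K (η w))
      (S.dcOutput w (OSS.Data.gain K (η w))) = 0 := fun w hw =>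
    (hopt w hw).slowField_eq_zero hT (hηu w hw) (hηz w hw) (hdf _ (hηu w hw)) (hdg _ (hηz w hw))
  have hcont := hd.continuousOn hε hS.lipschitz_g.continuousOn hηu hηz h0
  have hcu : ContinuousOn (fun w => OSS.Data.gain K (η w)) S.Wset :=
    (OSS.Data.gain K).continuous.comp_continuousOn hcont
  have hcz : ContinuousOn (fun w => S.dcOutput w (OSS.Data.gain K (η w))) S.Wset := by
    unfold OSS.Data.dcOutput
    exact ((OSS.mlin S.Gu).continuous.comp_continuousOn hcu).add
      (OSS.mlin S.Gw).continuous.continuousOn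
  -- The optimal inputs and outputs over all signals form compact subsets of the open domains, so
  -- one Lipschitz constant, hence one threshold, serves every `w`.
  obtain ⟨ℓu, hℓu⟩ := OSS.exists_uniform_lipschitz hS.lipschitz_f isOpen_interior
    (hS.compact_W.image_of_continuousOn hcu) (image_subset_iff.2 hηu)
  obtain ⟨ℓz, hℓz⟩ := OSS.exists_uniform_lipschitz hS.lipschitz_g isOpen_interior
    (hS.compact_W.image_of_continuousOn hcz) (image_subset_iff.2 hηz)
  obtain ⟨τ₀, hτ₀, hst⟩ := hd.exists_stable hε hS.hurwitz hsymm hc hcb (max ℓu ℓz)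
  refine ⟨τ₀, hτ₀, fun τ hτ w hw => ?_⟩
  have hτ0 : τ ≠ 0 := (hτ₀.trans_le hτ).ne'
  have hA := hS.hurwitz.isUnit_det
  have hAinj : ∀ x, OSS.mlin S.A x = 0 → x = 0 := by
    intro x hx
    have h1 := OSS.mlin_mul_apply S.A⁻¹ S.A x
    rw [hx, map_zero, nonsing_inv_mul _ hA] at h1
    apply WithLp.ofLp_injective
    rw [← h1, OSS.ofLp_mlin, one_mulVec]
  set p : OSS.Data.State n q nc := (S.dcState w (OSS.Data.gain K (η w)), η w) with hp
  have hout : S.output K w p = S.dcOutput w (OSS.Data.gain K p.2) := by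
    rw [OSS.Data.output_eq, hp, sub_self, map_zero, zero_add]
  refine ⟨p, ⟨⟨hηu w hw, ?_⟩, ?_⟩, ?_, ?_, ?_⟩
  · rw [hout]; exact hηz w hw
  · refine Prod.ext ?_ ?_
    · rw [OSS.Data.closedLoop_fst S hA, hp, sub_self, map_zero]; rfl
    · rw [OSS.Data.closedLoop_snd, hout, hp, h0 w hw, smul_zero]; rfl
  · rintro p' ⟨⟨hu', hz'⟩, heq⟩
    have e1 := congrArg Prod.fst heq
    have e2 := congrArg Prod.snd heq
    rw [OSS.Data.closedLoop_fst S hA] at e1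
    -- Invertibility of `A` puts the plant at its steady state, so `p'.2` is a zero of the reduced
    -- field and must equal `η w`.
    have e3 := sub_eq_zero.1 (hAinj _ e1)
    have hout' : S.output K w p' = S.dcOutput w (OSS.Data.gain K p'.2) := by
      rw [OSS.Data.output_eq, e3, sub_self, map_zero, zero_add]
    rw [hout'] at hz'
    rw [OSS.Data.closedLoop_snd, hout'] at e2
    have e4 := (smul_eq_zero.1 e2).resolve_left (inv_ne_zero hτ0)
    have e5 := hd.norm_sub_le hε hu' (hηu w hw) hz' (hηz w hw) e4
    rw [h0 w hw, norm_zero, mul_zero] at e5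
    have e6 : p'.2 = η w := sub_eq_zero.1 (norm_le_zero_iff.1 e5)
    exact Prod.ext (by rw [e3, e6]) e6
  · obtain ⟨tu, htu, hLu⟩ := hℓu _ (mem_image_of_mem _ hw)
    obtain ⟨tz, htz, hLz⟩ := hℓz _ (mem_image_of_mem _ hw)
    exact hst τ hτ w p rfl (hηu w hw) (hηz w hw) (h0 w hw)
      ⟨tu, htu, hLu.weaken (le_max_left _ _)⟩ ⟨tz, htz, hLz.weaken (le_max_right _ _)⟩
  · rw [hout]; exact hopt w hw
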